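/- Let $B_n$ denote the Bernoulli polynomials, $\sum_{n\ge 0}B_n(x)\frac{z^n}{n!}=\frac{e^{xz}}{g(z)}$, where $g$ is the entire function $g(z)=\frac{e^z-1}{z}$, $g(0)=1$, and let $\beta_n(x)=B_n(nx)$. Let $\Theta(t)=1$ for $t>0$, $\Theta(0)=\tfrac12$, $\Theta(t)=0$ for $t<0$; let $\mathrm{Arg}$ take values in $(-\pi,\pi]$; and let $\mathrm{Li}_n(z)=\sum_{k\ge1}z^k/k^n$ for $|z|<1$. For $\tau>0$ let $\theta_+(\tau)$ be the unique $\theta\in\mathbb{C}$ with $0<\mathrm{Re}\,\theta<\pi$, $\mathrm{Im}\,\theta<0$ and $e^{i\theta}-i\theta=1-\tau^2$, and define $\theta:\mathbb{R}\to\mathbb{C}$ by $\theta(\tau)=\theta_+(\tau)$ for $\tau>0$, $\theta(0)=0$, and $\theta(\tau)=-\overline{\theta_+(-\tau)}$ for $\tau<0$. Let $n\ge 1$ be an integer and $x\in\mathbb{C}\setminus\{0\}$. Then the principal value integral $$J_n(x)=\mathrm{PV}\!\int_{-\infty}^{+\infty}\frac{e^{-n\tau^2}\,\theta'(\tau)}{g\big(e^{i\theta(\tau)}/x\big)}\,d\tau$$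 exists, where the principal value is taken symmetrically in $\tau$ at the real zeros (if any) of $\tau\mapsto g(e^{i\theta(\tau)}/x)$, the integrand being absolutely integrable away from them, and the following hold. (1) If $\mathrm{Re}(x)\ne0$, then $$\frac{\beta_n(x)}{n!}=\frac{(ex)^n}{2\pi}J_n(x)-\frac{1}{(2\pi)^n}\sum_{k\ge1}\Theta\Big(\frac{\mathrm{Arg}(ix)}{2\pi\,\mathrm{Im}(ix)}-k\Big)\frac{e^{2k\pi i n x}}{(ik)^n}-\frac{1}{(2\pi)^n}\sum_{k\ge1}\Theta\Big(\frac{\mathrm{Arg}(-ix)}{2\pi\,\mathrm{Im}(-ix)}-k\Big)\frac{e^{-2k\pi i n x}}{(-ik)^n},$$ where both sums are finite. (2) If $x=iq$ with $q>0$, then $$\frac{\beta_n(x)}{n!}=\frac{(ex)^n}{2\pi}J_n(x)-\frac{1}{(2\pi i)^n}\mathrm{Li}_n\big(e^{2\pi i n x}\big)-\frac{1}{(2\pi)^n}\sum_{k\ge1}\Theta\Big(\frac{1}{2\pi\,\mathrm{Im}(x)}-k\Big)\frac{e^{-2\pi i k n x}}{(-ik)^n}.$$ (3) If $x=iq$ with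 $q<0$, then the complex conjugate formula holds: $$\frac{\beta_n(x)}{n!}=\frac{(ex)^n}{2\pi}J_n(x)-\frac{1}{(-2\pi i)^n}\mathrm{Li}_n\big(e^{-2\pi i n x}\big)-\frac{1}{(2\pi)^n}\sum_{k\ge1}\Theta\Big(\frac{1}{2\pi\,\mathrm{Im}(-x)}-k\Big)\frac{e^{2\pi i k n x}}{(ik)^n}.$$ -/

import Mathlib

open MeasureTheory Filter Topology

namespace RescaledBernoulli

/-- The entire function `g(z) = (e^z - 1) / z`, with `g(0) = 1`. -/
noncomputable def g (z : ℂ) : ℂ :=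
  if z = 0 then 1 else (Complex.exp z - 1) / z

/-- The rescaled Bernoulli polynomial `β_n(x) = B_n(n x)`. -/
noncomputable def beta (n : ℕ) (x : ℂ) : ℂ :=
  Polynomial.aeval ((n : ℂ) * x) (Polynomial.bernoulli n)

/-- The step function with value `1/2` at the origin. -/
noncomputable def step (t : ℝ) : ℝ :=
  if 0 < t then 1 else if t = 0 then 1 / 2 else 0

/-- The half-strip `0 < Re θ < π`, `Im θ < 0`. -/
def Omega : Set ℂ := {θ | 0 < θ.re ∧ θ.re < Real.pi ∧ θ.im < 0}

/-- The function `X ↦ X cot X + log (sin X / X)`: the value of `e^{iθ} - iθ` at the point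
`θ = X + i log (sin X / X)` of the steepest descent curve. -/
noncomputable def height (X : ℝ) : ℝ :=
  X * (Real.cos X / Real.sin X) + (Real.log (Real.sin X) - Real.log X)

theorem hasDerivAt_height {X : ℝ} (h0 : 0 < X) (hpi : X < Real.pi) :
    HasDerivAt height
      (-(((X - Real.sin X * Real.cos X) ^ 2 + Real.sin X ^ 4) / (X * Real.sin X ^ 2))) X := by
  have hs : 0 < Real.sin X := Real.sin_pos_of_pos_of_lt_pi h0 hpi
  have h := ((hasDerivAt_id X).mul
    ((Real.hasDerivAt_cos X).div (Real.hasDerivAt_sin X) hs.ne')).add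
    (((Real.hasDerivAt_sin X).log hs.ne').sub ((hasDerivAt_id X).log h0.ne'))
  refine h.congr_deriv ?_
  have hc : Real.cos X ^ 2 = 1 - Real.sin X ^ 2 := by
    have := Real.sin_sq_add_cos_sq X; linarith
  simp only [id, Pi.div_apply]
  field_simp
  ring_nf
  simp only [hc]
  ring

theorem height_strictAntiOn : StrictAntiOn height (Set.Ioo 0 Real.pi) := by
  refine strictAntiOn_of_deriv_neg (convex_Ioo _ _)
    (fun X hX => (hasDerivAt_height hX.1 hX.2).continuousAt.continuousWithinAt) ?_
  intro X hX
  rw [interior_Ioo] at hX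
  rw [(hasDerivAt_height hX.1 hX.2).deriv]
  have hs : 0 < Real.sin X := Real.sin_pos_of_pos_of_lt_pi hX.1 hX.2
  have h0 := hX.1
  have : 0 < ((X - Real.sin X * Real.cos X) ^ 2 + Real.sin X ^ 4) / (X * Real.sin X ^ 2) := by
    positivity
  linarith

theorem mem_Omega_and_eq_iff (τ : ℝ) (θ : ℂ) :
    (θ ∈ Omega ∧ Complex.exp (Complex.I * θ) - Complex.I * θ = 1 - (τ : ℂ) ^ 2) ↔
      (0 < θ.re ∧ θ.re < Real.pi ∧ θ.im = Real.log (Real.sin θ.re) - Real.log θ.re ∧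
        height θ.re = 1 - τ ^ 2) := by
  have hre : (Complex.exp (Complex.I * θ) - Complex.I * θ).re
      = Real.exp (-θ.im) * Real.cos θ.re + θ.im := by
    simp [Complex.exp_re]
  have him : (Complex.exp (Complex.I * θ) - Complex.I * θ).im
      = Real.exp (-θ.im) * Real.sin θ.re - θ.re := by
    simp [Complex.exp_im]
  have hr : ((1 : ℂ) - (τ : ℂ) ^ 2) = ((1 - τ ^ 2 : ℝ) : ℂ) := by push_cast; ring
  rw [hr, Complex.ext_iff, hre, him, Complex.ofReal_re, Complex.ofReal_im]
  have key : ∀ X Y : ℝ, 0 < X → X < Real.pi → Y = Real.log (Real.sin X) - Real.log X →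
      Real.exp (-Y) = X / Real.sin X := by
    intro X Y h0 hpi hY
    have hs : 0 < Real.sin X := Real.sin_pos_of_pos_of_lt_pi h0 hpi
    rw [hY, neg_sub, Real.exp_sub, Real.exp_log h0, Real.exp_log hs]
  constructor
  · rintro ⟨⟨h0, hpi, -⟩, h1, h2⟩
    have hs : 0 < Real.sin θ.re := Real.sin_pos_of_pos_of_lt_pi h0 hpi
    have hY : θ.im = Real.log (Real.sin θ.re) - Real.log θ.re := by
      have h3 : Real.exp (-θ.im) * Real.sin θ.re = θ.re := by linarith
      have h4 := congrArg Real.log h3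
      rw [Real.log_mul (Real.exp_pos _).ne' hs.ne', Real.log_exp] at h4
      linarith
    refine ⟨h0, hpi, hY, ?_⟩
    rw [key _ _ h0 hpi hY] at h1
    rw [← h1, height, ← hY]
    ring
  · rintro ⟨h0, hpi, hY, hh⟩
    have hs : 0 < Real.sin θ.re := Real.sin_pos_of_pos_of_lt_pi h0 hpi
    refine ⟨⟨h0, hpi, ?_⟩, ?_, ?_⟩
    · rw [hY]
      have := Real.log_lt_log hs (Real.sin_lt h0)
      linarith
    · rw [key _ _ h0 hpi hY, ← hh, height, ← hY]
      ring
    · rw [key _ _ h0 hpi hY]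
      field_simp
      ring

theorem tendsto_height_zero : Tendsto height (𝓝[>] 0) (𝓝 1) := by
  have hsinc : Tendsto (fun X : ℝ => Real.sinc X) (𝓝[>] 0) (𝓝 1) := by
    have := Real.continuous_sinc.tendsto 0
    rw [Real.sinc_zero] at this
    exact this.mono_left nhdsWithin_le_nhds
  have hcos : Tendsto Real.cos (𝓝[>] 0) (𝓝 1) := by
    have := Real.continuous_cos.tendsto 0
    rw [Real.cos_zero] at this
    exact this.mono_left nhdsWithin_le_nhds
  have h := (hcos.div hsinc one_ne_zero).add (hsinc.log one_ne_zero)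
  simp only [Real.log_one, div_one, add_zero] at h
  refine h.congr' ?_
  have hmem : Set.Ioo (0 : ℝ) Real.pi ∈ 𝓝[>] (0 : ℝ) := Ioo_mem_nhdsGT Real.pi_pos
  filter_upwards [hmem] with X hX
  have hs : 0 < Real.sin X := Real.sin_pos_of_pos_of_lt_pi hX.1 hX.2
  have hX0 : X ≠ 0 := hX.1.ne'
  simp only [Pi.div_apply, height, Real.sinc_of_ne_zero hX0]
  rw [Real.log_div hs.ne' hX0]
  field_simp

theorem exists_height_le (M : ℝ) : ∃ X ∈ Set.Ioo (0 : ℝ) Real.pi, height X ≤ M := by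
  have hs : Tendsto Real.sin (𝓝[<] Real.pi) (𝓝[>] 0) := by
    refine tendsto_nhdsWithin_iff.2 ⟨?_, ?_⟩
    · have := Real.continuous_sin.tendsto Real.pi
      rw [Real.sin_pi] at this
      exact this.mono_left nhdsWithin_le_nhds
    · have hmem : Set.Ioo (0 : ℝ) Real.pi ∈ 𝓝[<] Real.pi := Ioo_mem_nhdsLT Real.pi_pos
      filter_upwards [hmem] with X hX
      exact Real.sin_pos_of_pos_of_lt_pi hX.1 hX.2
  have hc : Tendsto (fun X : ℝ => X * Real.cos X) (𝓝[<] Real.pi) (𝓝 (-Real.pi)) := by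
    have h2 : Continuous (fun X : ℝ => X * Real.cos X) := by fun_prop
    exact (h2.tendsto' Real.pi (-Real.pi) (by simp)).mono_left nhdsWithin_le_nhds
  have h1 : Tendsto (fun X : ℝ => X * Real.cos X * (Real.sin X)⁻¹) (𝓝[<] Real.pi) atBot :=
    Tendsto.neg_mul_atTop (neg_neg_of_pos Real.pi_pos) hc (tendsto_inv_nhdsGT_zero.comp hs)
  have hmem : Set.Ioo (0 : ℝ) Real.pi ∈ 𝓝[<] Real.pi := Ioo_mem_nhdsLT Real.pi_pos
  obtain ⟨X, hXM, hX⟩ := ((h1.eventually_le_atBot M).and hmem).exists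
  refine ⟨X, hX, ?_⟩
  have hsX : 0 < Real.sin X := Real.sin_pos_of_pos_of_lt_pi hX.1 hX.2
  have hl := Real.log_lt_log hsX (Real.sin_lt hX.1)
  have : height X = X * Real.cos X * (Real.sin X)⁻¹
      + (Real.log (Real.sin X) - Real.log X) := by
    rw [height]; ring
  linarith

/-- For `τ > 0` the equation `e^{iθ} - iθ = 1 - τ²` has exactly one solution in `Omega`. -/
theorem existsUnique_thetaPlus {τ : ℝ} (hτ : 0 < τ) :
    ∃! θ : ℂ, θ ∈ Omega ∧
      Complex.exp (Complex.I * θ) - Complex.I * θ = 1 - (τ : ℂ) ^ 2 := by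
  have hlt : 1 - τ ^ 2 < 1 := by have : 0 < τ ^ 2 := by positivity
                                 linarith
  obtain ⟨b, hb, hbM⟩ := exists_height_le (1 - τ ^ 2)
  have hmem : Set.Ioo (0 : ℝ) Real.pi ∈ 𝓝[>] (0 : ℝ) := Ioo_mem_nhdsGT Real.pi_pos
  obtain ⟨a, haM, ha⟩ :=
    ((tendsto_height_zero.eventually (lt_mem_nhds hlt)).and hmem).exists
  have hcont : ContinuousOn height (Set.Ioo 0 Real.pi) := fun X hX =>
    (hasDerivAt_height hX.1 hX.2).continuousAt.continuousWithinAt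
  obtain ⟨X, hX, hXv⟩ := isPreconnected_Ioo.intermediate_value hb ha hcont ⟨hbM, haM.le⟩
  refine ⟨⟨X, Real.log (Real.sin X) - Real.log X⟩, ?_, ?_⟩
  · exact (mem_Omega_and_eq_iff τ _).2 ⟨hX.1, hX.2, rfl, hXv⟩
  · intro θ hθ
    obtain ⟨h0, hpi, hY, hh⟩ := (mem_Omega_and_eq_iff τ θ).1 hθ
    have hre : θ.re = X := height_strictAntiOn.injOn ⟨h0, hpi⟩ hX (hh.trans hXv.symm)
    apply Complex.ext
    · exact hre
    · simp only [hY, hre]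

/-- The solution `θ₊(τ)`, `τ > 0`, of `e^{iθ} - iθ = 1 - τ²` in `Omega`. -/
noncomputable def thetaPlus (τ : ℝ) (hτ : 0 < τ) : ℂ :=
  (existsUnique_thetaPlus hτ).choose

/-- The parametrization `θ : ℝ → ℂ` of the steepest descent curve through the saddle point `0`. -/
noncomputable def theta (τ : ℝ) : ℂ :=
  if h : 0 < τ then thetaPlus τ h
  else if h' : τ < 0 then -(starRingEnd ℂ) (thetaPlus (-τ) (neg_pos.2 h'))
  else 0

/-- The integrand `e^{-nτ²} θ'(τ) / g(e^{iθ(τ)} / x)`. -/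
noncomputable def integrand (n : ℕ) (x : ℂ) (τ : ℝ) : ℂ :=
  Complex.exp (-(n : ℂ) * (τ : ℂ) ^ 2) * deriv theta τ
    / g (Complex.exp (Complex.I * theta τ) / x)

/-- The points of the real line at which the integrand is singular. -/
def singularSet (x : ℂ) : Set ℝ :=
  {τ | g (Complex.exp (Complex.I * theta τ) / x) = 0}

/-- `I` is the Cauchy principal value of `∫ f` over the real line, with singularities at the
points of `S`: outside the symmetric `ε`-neighbourhoods of these points `f` is integrable, and its
integrals over what remains converge to `I` as `ε → 0⁺`. -/
def HasPVIntegral (f : ℝ → ℂ) (S : Set ℝ) (I : ℂ) : Prop :=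
  (∀ ε : ℝ, 0 < ε → IntegrableOn f {τ | ∀ s ∈ S, ε < |τ - s|} volume) ∧
    Tendsto (fun ε : ℝ => ∫ τ in {τ | ∀ s ∈ S, ε < |τ - s|}, f τ) (𝓝[>] 0) (𝓝 I)

/-- The sum `∑_{k ≥ 1} Θ(c - k) a_k`, a finite sum since `Θ(c - k) = 0` for `k > c`. -/
noncomputable def cutoffSum (c : ℝ) (a : ℕ → ℂ) : ℂ :=
  ∑ k ∈ Finset.Icc 1 ⌊c⌋₊, (step (c - k) : ℂ) * a k

/-- The polylogarithm `Li_n(z) = ∑_{k ≥ 1} z^k / k^n` in the unit disc `|z| < 1`. -/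
noncomputable def polylog (n : ℕ) (z : ℂ) : ℂ :=
  ∑' k : ℕ, z ^ (k + 1) / ((k : ℂ) + 1) ^ n

end RescaledBernoulli

/-!
Put `w = e^{iθ(τ)}`. Since `e^{iθ} - iθ = 1 - τ²`, we have `e^{-nτ²} = e^{-n} e^{nw} / w^n`, and the
integrand becomes `e^{-n} / i` times `K(w) dw`, where `K(w) = e^{nw} / (w^n x (e^{w/x} - 1))`. The
poles of `K` are the origin, where the generating function of the Bernoulli polynomials gives the
residue `B_n(nx) / (n! x^n)`, and the simple poles `2πikx` for integers `k ≠ 0`, with residues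
`e^{2πiknx} / (2πikx)^n`.

The curve traced by `w` is the graph `Re w = y cot y`, `y = Im w`, `|y| < π`. A piece of it is
closed by a vertical segment, and moving this segment to `Re w → -∞` between the poles makes its
contribution vanish. Poles inside the curve count once, poles on the curve count with weight `1/2`
in the principal value, and poles outside do not count. On the rays from the origin through `ix` and
`-ix`, comparison with the graph turns the weights into `Θ(Arg(±ix) / (2π Im(±ix)) - k)`. If `x` is
purely imaginary, one of the two rays is the negative real axis: all of its poles lie inside, and
their residues add up to the polylogarithm.
-/

namespace RescaledBernoulli

open Asymptotics
open Complex (I)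
open scoped Real ComplexConjugate

section Exponential

theorem tendsto_exp_sub_one_div :
    Tendsto (fun u : ℂ => (Complex.exp u - 1) / u) (𝓝[≠] 0) (𝓝 1) := by
  have h := (Complex.hasDerivAt_exp 0).tendsto_slope
  rw [Complex.exp_zero] at h
  refine h.congr fun u => ?_
  rw [slope_def_field, Complex.exp_zero, sub_zero]

theorem tendsto_exp_sub_one_sub_id_div_sq :
    Tendsto (fun u : ℂ => (Complex.exp u - 1 - u) / u ^ 2) (𝓝[≠] 0) (𝓝 (1 / 2)) := by
  have hexp : (fun u : ℂ => Complex.exp u - ∑ i ∈ Finset.range 3, u ^ i / (i.factorial : ℂ))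
      =o[𝓝 0] (· ^ 2) :=
    (Complex.exp_sub_sum_range_isBigO_pow 3).trans_isLittleO (isLittleO_pow_pow (by norm_num))
  have hlim := (hexp.mono (nhdsWithin_le_nhds (s := {0}ᶜ))).tendsto_div_nhds_zero.add_const
    (1 / 2 : ℂ)
  rw [zero_add] at hlim
  refine hlim.congr' ?_
  filter_upwards [self_mem_nhdsWithin] with u (hu : u ≠ 0)
  simp only [Finset.sum_range_succ, Finset.sum_range_zero, Nat.factorial]
  field_simp
  push_cast
  ring

theorem tendsto_exp_sub_one_sub_id_div_exp_sub_one_sq :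
    Tendsto (fun u : ℂ => (Complex.exp u - 1 - u) / (Complex.exp u - 1) ^ 2) (𝓝[≠] 0)
      (𝓝 (1 / 2)) := by
  have hlim := tendsto_exp_sub_one_sub_id_div_sq.div (tendsto_exp_sub_one_div.pow 2) (by norm_num)
  rw [one_pow, div_one] at hlim
  refine hlim.congr' ?_
  filter_upwards [self_mem_nhdsWithin] with u (hu : u ≠ 0)
  simp only [Pi.div_apply]
  field_simp

theorem one_sub_exp_neg_abs_re_le_norm_exp_sub_one (u : ℂ) :
    1 - Real.exp (-|u.re|) ≤ ‖Complex.exp u - 1‖ := by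
  have hnorm := abs_norm_sub_norm_le (Complex.exp u) 1
  rw [Complex.norm_exp, norm_one] at hnorm
  refine le_trans ?_ hnorm
  rcases abs_cases u.re with ⟨habs, _⟩ | ⟨habs, -⟩ <;> rw [habs]
  · refine le_trans ?_ (le_abs_self _)
    linarith [Real.add_one_le_exp u.re, Real.add_one_le_exp (-u.re)]
  · rw [neg_neg]
    exact le_trans (by linarith) (neg_le_abs _)

end Exponential

section Logarithm

theorem hasDerivAt_log_sub {w a : ℂ} (h : w - a ∈ Complex.slitPlane) :
    HasDerivAt (fun z => Complex.log (z - a)) ((w - a)⁻¹) w := by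
  simpa only [one_div] using ((hasDerivAt_id' w).sub_const a).clog h

theorem hasDerivAt_log_const_sub {w a : ℂ} (h : a - w ∈ Complex.slitPlane) :
    HasDerivAt (fun z => Complex.log (a - z)) ((w - a)⁻¹) w := by
  refine (((hasDerivAt_id' w).const_sub a).clog h).congr_deriv ?_
  rw [← neg_sub w a, neg_div_neg_eq, one_div]

theorem continuousAt_inv_sub {w a : ℂ} (h : w ≠ a) : ContinuousAt (fun z => (z - a)⁻¹) w :=
  ContinuousAt.inv₀ (by fun_prop) (sub_ne_zero.2 h)

theorem ne_of_sub_mem_slitPlane {w a : ℂ} (h : w - a ∈ Complex.slitPlane) : w ≠ a :=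
  sub_ne_zero.1 (Complex.slitPlane_ne_zero h)

theorem log_neg_of_im_pos {u : ℂ} (h : 0 < u.im) :
    Complex.log (-u) = Complex.log u - π * I := by
  rw [Complex.log, Complex.log, Complex.arg_neg_eq_arg_sub_pi_of_im_pos h, norm_neg]
  push_cast
  ring

theorem log_neg_of_im_neg {u : ℂ} (h : u.im < 0) :
    Complex.log (-u) = Complex.log u + π * I := by
  rw [Complex.log, Complex.log, Complex.arg_neg_eq_arg_add_pi_of_im_neg h, norm_neg]
  push_cast
  ring

theorem tendsto_slope_zero_left {E : Type*} [NormedAddCommGroup E] [NormedSpace ℝ E]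
    {γ : ℝ → E} {γ' : E} {s : ℝ} (hγ : HasDerivAt γ γ' s) :
    Tendsto (fun ε : ℝ => ε⁻¹ • (γ (s - ε) - γ s)) (𝓝[>] 0) (𝓝 (-γ')) := by
  have hneg : Tendsto (fun ε : ℝ => -ε) (𝓝[>] 0) (𝓝[≠] 0) := by
    refine tendsto_nhdsWithin_iff.2 ⟨?_, ?_⟩
    · exact (continuous_neg.tendsto' (0 : ℝ) 0 neg_zero).mono_left nhdsWithin_le_nhds
    · filter_upwards [self_mem_nhdsWithin] with ε hε
      exact neg_ne_zero.2 (ne_of_gt hε)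
  refine (hγ.tendsto_slope_zero.comp hneg).neg.congr fun ε => ?_
  simp only [Function.comp, inv_neg, neg_smul, neg_neg, sub_eq_add_neg]

/- Dividing both differences by `ε` does not change the difference of their logarithms, and the
quotients tend to `∓γ'`. -/
theorem tendsto_log_sub_log_of_hasDerivAt {γ : ℝ → ℂ} {γ' : ℂ} {s : ℝ} (hγ : HasDerivAt γ γ' s)
    (hpos : 0 < γ'.im) :
    Tendsto (fun ε : ℝ => Complex.log (γ (s - ε) - γ s) - Complex.log (γ (s + ε) - γ s))
      (𝓝[>] 0) (𝓝 (-(π * I))) := by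
  have hright : Tendsto (fun ε : ℝ => ε⁻¹ • (γ (s + ε) - γ s)) (𝓝[>] 0) (𝓝 γ') :=
    hγ.tendsto_slope_zero_right
  have hleft := tendsto_slope_zero_left hγ
  have hslit : γ' ∈ Complex.slitPlane := Or.inr hpos.ne'
  have hslit' : -γ' ∈ Complex.slitPlane := Or.inr (neg_ne_zero.2 hpos.ne')
  have hlog := (hleft.clog hslit').sub (hright.clog hslit)
  rw [log_neg_of_im_pos hpos, sub_sub_cancel_left] at hlog
  refine hlog.congr' ?_
  filter_upwards [self_mem_nhdsWithin, hright.eventually_ne (Complex.slitPlane_ne_zero hslit),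
    hleft.eventually_ne (Complex.slitPlane_ne_zero hslit')] with ε (hε : 0 < ε) hr hl
  rw [Complex.real_smul, Complex.real_smul,
    Complex.log_ofReal_mul (inv_pos.2 hε) (right_ne_zero_of_smul hl),
    Complex.log_ofReal_mul (inv_pos.2 hε) (right_ne_zero_of_smul hr)]
  ring

end Logarithm

section RemovableSingularity

variable {E : Type*} [NormedAddCommGroup E] [NormedSpace ℂ E]

theorem isLittleO_sub_inv_of_tendsto_smul_zero {f : ℂ → E} {p : ℂ}
    (hf : Tendsto (fun z => (z - p) • f z) (𝓝[≠] p) (𝓝 0)) :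
    (fun z => f z - f p) =o[𝓝[≠] p] fun z => (z - p)⁻¹ := by
  have hconst : Tendsto (fun z => (z - p) • f p) (𝓝[≠] p) (𝓝 0) := by
    have hcont : Continuous fun z => (z - p) • f p := by fun_prop
    exact (hcont.tendsto' p 0 (by simp)).mono_left nhdsWithin_le_nhds
  have hlim : (fun z => (z - p) • (f z - f p)) =o[𝓝[≠] p] (1 : ℂ → ℂ) := by
    refine (isLittleO_one_iff ℂ).2 ?_
    simpa only [smul_sub, sub_zero] using hf.sub hconst
  refine ((isBigO_refl (fun z => (z - p)⁻¹) _).smul_isLittleO hlim).congr' ?_ ?_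
  · filter_upwards [self_mem_nhdsWithin] with z hz
    exact inv_smul_smul₀ (sub_ne_zero.2 hz) _
  · exact Eventually.of_forall fun z => mul_one _

theorem exists_differentiableOn_extension [CompleteSpace E] {U P : Set ℂ} (hU : IsOpen U)
    (hP : P.Finite) {f : ℂ → E} (hf : ∀ w ∈ U, w ∉ P → DifferentiableAt ℂ f w)
    (hp : ∀ p ∈ P, p ∈ U → Tendsto (fun z => (z - p) • f z) (𝓝[≠] p) (𝓝 0)) :
    ∃ h : ℂ → E, DifferentiableOn ℂ h U ∧ ∀ w, w ∉ P → h w = f w := by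
  classical
  refine ⟨fun w => if w ∈ P then limUnder (𝓝[≠] w) f else f w, fun w hw => ?_,
    fun w hw => if_neg hw⟩
  refine DifferentiableAt.differentiableWithinAt ?_
  have hs : (U \ (P \ {w})) ∈ 𝓝 w :=
    (hU.sdiff (hP.subset Set.sdiff_subset).isClosed).mem_nhds ⟨hw, fun h => h.2 rfl⟩
  by_cases hwP : w ∈ P
  · have hd : DifferentiableOn ℂ f ((U \ (P \ {w})) \ {w}) := fun z hz =>
      (hf z hz.1.1 fun hzP => hz.1.2 ⟨hzP, hz.2⟩).differentiableWithinAt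
    refine ((Complex.differentiableOn_update_limUnder_of_isLittleO hs hd
      (isLittleO_sub_inv_of_tendsto_smul_zero (hp w hwP hw))).differentiableAt
        hs).congr_of_eventuallyEq ?_
    filter_upwards [hs] with z hz
    rcases eq_or_ne z w with rfl | hzw
    · rw [if_pos hwP, Function.update_self]
    · rw [if_neg fun h => hz.2 ⟨h, hzw⟩, Function.update_of_ne hzw]
  · refine (hf w hw hwP).congr_of_eventuallyEq ?_
    filter_upwards [hs] with z hz
    exact if_neg fun h => hz.2 ⟨h, fun hzw => hwP (hzw ▸ h)⟩

end RemovableSingularity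

section TaylorTruncation

open Polynomial PowerSeries

variable {𝕜 : Type*} [NormedField 𝕜]

/-- The function `f` agrees with the power series `F` at the origin up to terms of order `N`. -/
def HasTaylorTrunc (f : 𝕜 → 𝕜) (F : 𝕜⟦X⟧) (N : ℕ) : Prop :=
  (fun u => f u - (F.trunc N).eval u) =O[𝓝 0] fun u => u ^ N

theorem isBigO_pow_of_coeff_eq_zero {p : 𝕜[X]} {N : ℕ} (hp : ∀ d < N, p.coeff d = 0) :
    (fun u => p.eval u) =O[𝓝 0] fun u => u ^ N := by
  obtain ⟨q, rfl⟩ := Polynomial.X_pow_dvd_iff.2 hp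
  simpa only [eval_mul, eval_pow, eval_X, mul_one] using
    (isBigO_refl (fun u : 𝕜 => u ^ N) (𝓝 0)).mul (q.continuous.continuousAt.isBigO_one 𝕜)

theorem hasTaylorTrunc_eval (p : 𝕜[X]) (N : ℕ) :
    HasTaylorTrunc (fun u => p.eval u) (p : 𝕜⟦X⟧) N := by
  refine (isBigO_pow_of_coeff_eq_zero (p := p - (p : 𝕜⟦X⟧).trunc N) fun d hd => ?_).congr_left
    fun _ => eval_sub ..
  rw [Polynomial.coeff_sub, PowerSeries.coeff_trunc, if_pos hd, Polynomial.coeff_coe, sub_self]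

namespace HasTaylorTrunc

variable {f f' : 𝕜 → 𝕜} {F F' : 𝕜⟦X⟧} {N : ℕ}

theorem sub (hf : HasTaylorTrunc f F N) (hf' : HasTaylorTrunc f' F' N) :
    HasTaylorTrunc (fun u => f u - f' u) (F - F') N := by
  refine (IsBigO.sub hf hf').congr_left fun u => ?_
  rw [PowerSeries.trunc_sub, eval_sub]
  ring

theorem isBigO_one (hf : HasTaylorTrunc f F N) : f =O[𝓝 0] (1 : 𝕜 → 𝕜) := by
  have hpow : (fun u : 𝕜 => u ^ N) =O[𝓝 0] (1 : 𝕜 → 𝕜) :=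
    (continuous_pow N).continuousAt.isBigO_one 𝕜
  refine ((IsBigO.trans hf hpow).add ((F.trunc N).continuous.continuousAt.isBigO_one 𝕜)).congr_left
    fun u => sub_add_cancel ..

theorem mul (hf : HasTaylorTrunc f F N) (hf' : HasTaylorTrunc f' F' N) :
    HasTaylorTrunc (fun u => f u * f' u) (F * F') N := by
  have htrunc := isBigO_pow_of_coeff_eq_zero
    (p := F.trunc N * F'.trunc N - (F * F').trunc N) (N := N) fun d hd => by
      rw [Polynomial.coeff_sub, PowerSeries.coeff_trunc, if_pos hd,
        PowerSeries.coeff_mul_eq_coeff_trunc_mul_trunc _ _ hd, ← Polynomial.coe_mul,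
        Polynomial.coeff_coe, sub_self]
  have hleft := IsBigO.mul hf hf'.isBigO_one
  have hright := ((F.trunc N).continuous.continuousAt.isBigO_one 𝕜).mul hf'
  simp only [Pi.one_apply, one_mul, mul_one] at hleft hright
  refine ((hleft.add hright).add htrunc).congr_left fun u => ?_
  rw [eval_sub, eval_mul]
  ring

theorem isBigO_sub (hf : HasTaylorTrunc f F N) (hf' : HasTaylorTrunc f' F N) :
    (fun u => f u - f' u) =O[𝓝 0] fun u => u ^ N :=
  (IsBigO.sub hf hf').congr_left fun _ => sub_sub_sub_cancel_right ..

end HasTaylorTrunc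

theorem hasTaylorTrunc_exp_const_mul (t : ℂ) (N : ℕ) :
    HasTaylorTrunc (fun u => Complex.exp (t * u)) (rescale t (PowerSeries.exp ℂ)) N := by
  have hexp := (Complex.exp_sub_sum_range_isBigO_pow N).comp_tendsto
    ((continuous_const_mul t).tendsto' 0 0 (mul_zero t))
  simp only [Function.comp_def, mul_pow] at hexp
  refine (hexp.trans (isBigO_const_mul_self _ _ _)).congr_left fun u => ?_
  rw [Polynomial.eval, PowerSeries.eval₂_trunc_eq_sum_range]
  congr 1
  refine Finset.sum_congr rfl fun j _ => ?_
  rw [coeff_rescale, coeff_exp, RingHom.id_apply, map_div₀, map_one, map_natCast]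
  ring

theorem hasTaylorTrunc_exp_sub_one (N : ℕ) :
    HasTaylorTrunc (fun u => Complex.exp u - 1) (PowerSeries.exp ℂ - 1) N := by
  have h := (hasTaylorTrunc_exp_const_mul 1 N).sub (hasTaylorTrunc_eval 1 N)
  simpa only [one_mul, rescale_one, RingHom.id_apply, eval_one, Polynomial.coe_one] using h

end TaylorTruncation

section BernoulliGeneratingFunction

/-- The coefficients `B_j(t) / j!` of the generating function `z e^{tz} / (e^z - 1)` of the
Bernoulli polynomials. -/
noncomputable def bernoulliCoeff (t : ℂ) (j : ℕ) : ℂ :=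
  Polynomial.aeval t (Polynomial.bernoulli j) / (j.factorial : ℂ)

theorem bernoulliCoeff_generating_function (t : ℂ) :
    PowerSeries.mk (bernoulliCoeff t) * (PowerSeries.exp ℂ - 1) =
      PowerSeries.X * PowerSeries.rescale t (PowerSeries.exp ℂ) := by
  rw [← Polynomial.bernoulli_generating_function]
  congr 2
  ext j
  rw [bernoulliCoeff, map_smul, Rat.smul_def]
  push_cast
  ring

theorem isBigO_sub_sum_bernoulliCoeff_mul (t : ℂ) (N : ℕ) :
    (fun u : ℂ => u * Complex.exp (t * u)
      - (∑ j ∈ Finset.range N, bernoulliCoeff t j * u ^ j) * (Complex.exp u - 1))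
      =O[𝓝 0] fun u => u ^ N := by
  have hX := (hasTaylorTrunc_eval Polynomial.X N).mul (hasTaylorTrunc_exp_const_mul t N)
  have hB := (show HasTaylorTrunc
    (fun u => ((PowerSeries.mk (bernoulliCoeff t)).trunc N).eval u) (.mk (bernoulliCoeff t)) N by
      simpa only [HasTaylorTrunc, sub_self] using isBigO_zero _ _).mul
    (hasTaylorTrunc_exp_sub_one N)
  rw [bernoulliCoeff_generating_function] at hB
  rw [Polynomial.coe_X] at hX
  refine (hX.isBigO_sub hB).congr_left fun u => ?_
  simp only [Polynomial.eval_X]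
  rw [Polynomial.eval, PowerSeries.eval₂_trunc_eq_sum_range]
  simp only [RingHom.id_apply, PowerSeries.coeff_mk]

theorem tendsto_bernoulli_remainder (t : ℂ) (n : ℕ) :
    Tendsto (fun u : ℂ => (u * Complex.exp (t * u) / (Complex.exp u - 1)
      - ∑ j ∈ Finset.range (n + 1), bernoulliCoeff t j * u ^ j) / u ^ n) (𝓝[≠] 0) (𝓝 0) := by
  have hid : Tendsto (fun u : ℂ => u) (𝓝[≠] 0) (𝓝 0) := nhdsWithin_le_nhds
  have hrem : Tendsto (fun u : ℂ => (u * Complex.exp (t * u)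
      - (∑ j ∈ Finset.range (n + 2), bernoulliCoeff t j * u ^ j) * (Complex.exp u - 1))
      / u ^ (n + 1)) (𝓝[≠] 0) (𝓝 0) :=
    (((isBigO_sub_sum_bernoulliCoeff_mul t (n + 2)).trans_isLittleO
      (isLittleO_pow_pow (by omega))).mono nhdsWithin_le_nhds).tendsto_div_nhds_zero
  have hlim := (hrem.div tendsto_exp_sub_one_div one_ne_zero).add
    (hid.const_mul (bernoulliCoeff t (n + 1)))
  simp only [zero_div, mul_zero, add_zero] at hlim
  refine hlim.congr' ?_
  filter_upwards [self_mem_nhdsWithin, tendsto_exp_sub_one_div.eventually_ne one_ne_zero]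
    with u (hu : u ≠ 0) hne
  have he : Complex.exp u - 1 ≠ 0 := fun h => hne (by rw [h, zero_div])
  simp only [Pi.div_apply]
  rw [Finset.sum_range_succ _ (n + 1)]
  field_simp
  ring

end BernoulliGeneratingFunction

section PrincipalValue

theorem HasPVIntegral.unique {f : ℝ → ℂ} {S : Set ℝ} {J J' : ℂ} (hJ : HasPVIntegral f S J)
    (hJ' : HasPVIntegral f S J') : J = J' :=
  tendsto_nhds_unique hJ.2 hJ'.2

/-- The real line without the symmetric `ε`-neighbourhoods of the points of `S`: the domain over
which the integrals approximating a principal value are taken. -/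
def awayFrom (S : Set ℝ) (ε : ℝ) : Set ℝ := {τ | ∀ s ∈ S, ε < |τ - s|}

theorem measurableSet_awayFrom {S : Set ℝ} (hS : S.Finite) (ε : ℝ) :
    MeasurableSet (awayFrom S ε) := by
  simp only [awayFrom, Set.ofPred_forall]
  exact hS.measurableSet_biInter fun s _ => measurableSet_lt measurable_const (by fun_prop)

theorem eventually_mem_awayFrom {S : Set ℝ} (hS : S.Finite) {τ : ℝ} (hτ : τ ∉ S) :
    ∀ᶠ ε in 𝓝[>] (0 : ℝ), τ ∈ awayFrom S ε := by
  refine hS.eventually_all.2 fun s hs => ?_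
  have hpos : 0 < |τ - s| := abs_pos.2 (sub_ne_zero.2 fun h => hτ (h ▸ hs))
  exact (eventually_lt_nhds hpos).filter_mono nhdsWithin_le_nhds

theorem awayFrom_sdiff_awayFrom_singleton {S : Set ℝ} {s ε δ : ℝ} (hs : s ∈ S)
    (hsep : ∀ s' ∈ S, s' ≠ s → ε + δ < |s' - s|) :
    awayFrom S ε \ awayFrom {s} δ = awayFrom {s} ε \ awayFrom {s} δ := by
  ext τ
  refine ⟨fun h => ⟨?_, h.2⟩, fun h => ⟨fun s' hs' => ?_, h.2⟩⟩
  · rintro _ rfl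
    exact h.1 _ hs
  · rcases eq_or_ne s' s with rfl | hne
    · exact h.1 _ rfl
    · have hnear : |τ - s| ≤ δ := by
        by_contra! hc
        refine h.2 ?_
        rintro _ rfl
        exact hc
      have htri := abs_sub_le s' τ s
      rw [abs_sub_comm s' τ] at htri
      linarith [hsep s' hs' hne]

theorem exists_pos_forall_le_abs_sub {S : Set ℝ} (hS : S.Finite) (s : ℝ) :
    ∃ r > 0, ∀ s' ∈ S, s' ≠ s → r ≤ |s' - s| := by
  have hmem : (S \ {s})ᶜ ∈ 𝓝 s :=
    (hS.subset Set.sdiff_subset).isClosed.isOpen_compl.mem_nhds fun h => h.2 rfl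
  obtain ⟨r, hr, hball⟩ := Metric.mem_nhds_iff.1 hmem
  refine ⟨r, hr, fun s' hs' hne => ?_⟩
  by_contra! hc
  exact hball (Metric.mem_ball.2 hc) ⟨hs', hne⟩

variable {E : Type*} [NormedAddCommGroup E] {S : Set ℝ} {f : ℝ → E} {a b s ε : ℝ}

theorem integrableOn_awayFrom_inter_Icc (hε : 0 < ε)
    (hf : ContinuousOn f (Set.Icc a b \ S)) :
    IntegrableOn f (awayFrom S ε ∩ Set.Icc a b) := by
  have hclosed : IsClosed (⋂ s ∈ S, {τ : ℝ | ε ≤ |τ - s|}) :=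
    isClosed_biInter fun s _ => isClosed_le continuous_const (by fun_prop)
  have hcont : ContinuousOn f (Set.Icc a b ∩ ⋂ s ∈ S, {τ : ℝ | ε ≤ |τ - s|}) := by
    refine hf.mono fun τ hτ => ⟨hτ.1, fun hS => ?_⟩
    have hle : ε ≤ |τ - τ| := Set.mem_iInter₂.1 hτ.2 τ hS
    rw [sub_self, abs_zero] at hle
    exact hle.not_gt hε
  refine (hcont.integrableOn_compact (isCompact_Icc.inter_right hclosed)).mono_set fun τ hτ => ?_
  exact ⟨hτ.2, Set.mem_iInter₂.2 fun s hs => (hτ.1 s hs).le⟩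

variable [NormedSpace ℝ E]

theorem tendsto_setIntegral_compl_Icc {T₀ : ℝ} (hf : IntegrableOn f (Set.Icc (-T₀) T₀)ᶜ) :
    Tendsto (fun T : ℝ => ∫ τ in (Set.Icc (-T) T)ᶜ, f τ) atTop (𝓝 0) := by
  have hanti : Antitone fun T : ℝ => (Set.Icc (-T) T)ᶜ := fun T T' h =>
    Set.compl_subset_compl.2 (Set.Icc_subset_Icc (neg_le_neg h) h)
  have hempty : ⋂ T : ℝ, (Set.Icc (-T) T)ᶜ = ∅ :=
    Set.eq_empty_of_forall_notMem fun τ hτ => Set.mem_iInter.1 hτ |τ| (abs_le.1 le_rfl)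
  simpa only [hempty, setIntegral_empty] using
    tendsto_setIntegral_of_antitone (fun _ => measurableSet_Icc.compl) hanti ⟨T₀, hf⟩

theorem tendsto_setIntegral_awayFrom_inter (hS : S.Finite) {B : Set ℝ} (hf : IntegrableOn f B) :
    Tendsto (fun ε : ℝ => ∫ τ in awayFrom S ε ∩ B, f τ) (𝓝[>] 0) (𝓝 (∫ τ in B, f τ)) := by
  have hindicator : ∀ ε, ∫ τ in awayFrom S ε ∩ B, f τ = ∫ τ in B, (awayFrom S ε).indicator f τ :=
    fun ε => by rw [setIntegral_indicator (measurableSet_awayFrom hS ε), Set.inter_comm]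
  simp_rw [hindicator]
  refine tendsto_integral_filter_of_dominated_convergence (fun τ => ‖f τ‖) ?_ ?_ hf.norm ?_
  · exact Eventually.of_forall fun ε =>
      hf.aestronglyMeasurable.indicator (measurableSet_awayFrom hS ε)
  · exact Eventually.of_forall fun ε => ae_of_all _ fun τ => norm_indicator_le_norm_self _ _
  · have hnotMem : ∀ᵐ τ ∂(volume.restrict B), τ ∉ S :=
      ae_restrict_of_ae (measure_eq_zero_iff_ae_notMem.1 (hS.measure_zero _))
    filter_upwards [hnotMem] with τ hτ
    refine tendsto_const_nhds.congr' ?_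
    filter_upwards [eventually_mem_awayFrom hS hτ] with ε hε
    exact (Set.indicator_of_mem hε _).symm

theorem setIntegral_awayFrom_inter_Icc_eq_add (hs : s ∈ S) {δ : ℝ} (hε : 0 < ε)
    (hsep : ∀ s' ∈ S, s' ≠ s → ε + δ < |s' - s|)
    (hf : ContinuousOn f (Set.Icc a b \ {s})) :
    ∫ τ in awayFrom S ε ∩ Set.Icc a b, f τ =
      (∫ τ in awayFrom S ε ∩ (awayFrom {s} δ ∩ Set.Icc a b), f τ) +
        ∫ τ in (awayFrom {s} ε \ awayFrom {s} δ) ∩ Set.Icc a b, f τ := by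
  have hint : IntegrableOn f (awayFrom S ε ∩ Set.Icc a b) :=
    integrableOn_awayFrom_inter_Icc hε
      (hf.mono (Set.sdiff_subset_sdiff_right (Set.singleton_subset_iff.2 hs)))
  rw [← awayFrom_sdiff_awayFrom_singleton hs hsep,
    ← integral_inter_add_sdiff (measurableSet_awayFrom (Set.finite_singleton s) δ) hint]
  congr 3
  · exact Set.inter_assoc _ _ _ |>.trans (congrArg _ (Set.inter_comm _ _))
  · rw [Set.inter_comm, Set.inter_sdiff_assoc, Set.inter_comm]

/- Away from `s` the two families of domains have the same limit, near `s` they coincide. -/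
theorem tendsto_setIntegral_awayFrom_of_singleton (hS : S.Finite) (hs : s ∈ S)
    (hf : ContinuousOn f (Set.Icc a b \ {s})) {L : E}
    (h : Tendsto (fun ε : ℝ => ∫ τ in awayFrom {s} ε ∩ Set.Icc a b, f τ) (𝓝[>] 0) (𝓝 L)) :
    Tendsto (fun ε : ℝ => ∫ τ in awayFrom S ε ∩ Set.Icc a b, f τ) (𝓝[>] 0) (𝓝 L) := by
  obtain ⟨r, hr, hsep⟩ := exists_pos_forall_le_abs_sub hS s
  have hint : IntegrableOn f (awayFrom {s} (r / 2) ∩ Set.Icc a b) :=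
    integrableOn_awayFrom_inter_Icc (half_pos hr) hf
  have hdiff := ((tendsto_setIntegral_awayFrom_inter hS hint).sub
    (tendsto_setIntegral_awayFrom_inter (Set.finite_singleton s) hint)).add h
  rw [sub_self, zero_add] at hdiff
  refine hdiff.congr' ?_
  filter_upwards [self_mem_nhdsWithin,
    (eventually_lt_nhds (half_pos hr)).filter_mono nhdsWithin_le_nhds] with ε (hε : 0 < ε) hεr
  rw [setIntegral_awayFrom_inter_Icc_eq_add (δ := r / 2) hs hε
      (fun s' hs' hne => (hsep s' hs' hne).trans_lt' (by linarith)) hf,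
    setIntegral_awayFrom_inter_Icc_eq_add (δ := r / 2) (Set.mem_singleton s) hε
      (fun s' hs' hne => absurd hs' hne) hf]
  abel

theorem awayFrom_singleton_inter_Icc (hε : 0 < ε) (ha : a ≤ s - ε) (hb : s + ε ≤ b) :
    awayFrom {s} ε ∩ Set.Icc a b = Set.Ico a (s - ε) ∪ Set.Ioc (s + ε) b := by
  ext τ
  simp only [awayFrom, Set.mem_singleton_iff, forall_eq, Set.mem_inter_iff, Set.mem_ofPred_eq,
    Set.mem_Icc, Set.mem_union, Set.mem_Ico, Set.mem_Ioc, lt_abs]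
  grind

theorem setIntegral_awayFrom_singleton_inter_Icc (hε : 0 < ε) (ha : a ≤ s - ε) (hb : s + ε ≤ b)
    (hf : ContinuousOn f (Set.Icc a b \ {s})) :
    ∫ τ in awayFrom {s} ε ∩ Set.Icc a b, f τ =
      (∫ τ in a..(s - ε), f τ) + ∫ τ in (s + ε)..b, f τ := by
  have hint : IntegrableOn f (awayFrom {s} ε ∩ Set.Icc a b) :=
    integrableOn_awayFrom_inter_Icc hε hf
  have hdisj : Disjoint (Set.Ico a (s - ε)) (Set.Ioc (s + ε) b) :=
    Set.disjoint_left.2 fun τ hl hr => by linarith [hl.2, hr.1]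
  rw [awayFrom_singleton_inter_Icc hε ha hb] at hint ⊢
  rw [setIntegral_union hdisj measurableSet_Ioc (hint.mono_set Set.subset_union_left)
      (hint.mono_set Set.subset_union_right), integral_Ico_eq_integral_Ioo,
    ← integral_Ioc_eq_integral_Ioo, intervalIntegral.integral_of_le ha,
    intervalIntegral.integral_of_le hb]

end PrincipalValue

section SteepestDescentCurve

theorem theta_spec {τ : ℝ} (hτ : 0 < τ) :
    theta τ ∈ Omega ∧ Complex.exp (I * theta τ) - I * theta τ = 1 - (τ : ℂ) ^ 2 := by
  rw [theta, dif_pos hτ]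
  exact (existsUnique_thetaPlus hτ).choose_spec.1

theorem theta_zero : theta 0 = 0 := by
  simp only [theta, lt_irrefl, dite_false]

theorem theta_neg (τ : ℝ) : theta (-τ) = -conj (theta τ) := by
  rcases lt_trichotomy τ 0 with h | rfl | h
  · simp [theta, h, h.not_gt]
  · simp [theta]
  · simp [theta, h, h.not_gt]

/-- The abscissa `Re θ(τ)`; it is also the argument and the imaginary part of `e^{iθ(τ)}`. -/
noncomputable def angle (τ : ℝ) : ℝ := (theta τ).re

/-- The curve `τ ↦ e^{iθ(τ)}`, along which the contour integral is taken. -/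
noncomputable def curve (τ : ℝ) : ℂ := Complex.exp (I * theta τ)

theorem curve_ne_zero (τ : ℝ) : curve τ ≠ 0 := Complex.exp_ne_zero _

theorem angle_neg (τ : ℝ) : angle (-τ) = -angle τ := by
  simp only [angle, theta_neg, Complex.neg_re, Complex.conj_re]

theorem angle_zero : angle 0 = 0 := by
  rw [angle, theta_zero, Complex.zero_re]

theorem angle_mem_Ioo_of_pos {τ : ℝ} (hτ : 0 < τ) : angle τ ∈ Set.Ioo 0 π :=
  ⟨(theta_spec hτ).1.1, (theta_spec hτ).1.2.1⟩

theorem height_angle {τ : ℝ} (hτ : 0 < τ) : height (angle τ) = 1 - τ ^ 2 :=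
  ((mem_Omega_and_eq_iff τ (theta τ)).1 (theta_spec hτ)).2.2.2

theorem curve_neg (τ : ℝ) : curve (-τ) = conj (curve τ) := by
  rw [curve, curve, theta_neg, ← Complex.exp_conj, map_mul, Complex.conj_I, mul_neg, neg_mul]

theorem curve_zero : curve 0 = 1 := by
  rw [curve, theta_zero, mul_zero, Complex.exp_zero]

theorem curve_sub_I_mul_theta (τ : ℝ) : curve τ - I * theta τ = 1 - (τ : ℂ) ^ 2 := by
  rcases lt_trichotomy τ 0 with h | rfl | h
  · have hconj := congrArg conj (theta_spec (neg_pos.2 h)).2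
    rw [← curve, map_sub, map_mul, Complex.conj_I, ← curve_neg, neg_mul_comm, ← theta_neg,
      neg_neg] at hconj
    simpa using hconj
  · simp [curve_zero, theta_zero]
  · exact (theta_spec h).2

theorem curve_im (τ : ℝ) : (curve τ).im = angle τ := by
  have h := congrArg Complex.im (curve_sub_I_mul_theta τ)
  rw [← Complex.ofReal_pow, ← Complex.ofReal_one, ← Complex.ofReal_sub, Complex.ofReal_im,
    Complex.sub_im, Complex.I_mul_im] at h
  exact sub_eq_zero.1 h

theorem height_lt_one {X : ℝ} (hX : X ∈ Set.Ioo 0 π) : height X < 1 := by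
  have hhalf : X / 2 ∈ Set.Ioo 0 π := ⟨by linarith [hX.1], by linarith [hX.1, hX.2]⟩
  refine (height_strictAntiOn hhalf hX (by linarith [hX.1])).trans_le
    (ge_of_tendsto tendsto_height_zero ?_)
  filter_upwards [Ioo_mem_nhdsGT hhalf.1] with y hy
  exact (height_strictAntiOn ⟨hy.1, hy.2.trans hhalf.2⟩ hhalf hy.2).le

theorem exists_angle_eq_of_pos {X : ℝ} (hX : X ∈ Set.Ioo 0 π) : ∃ τ, angle τ = X := by
  have hpos : 0 < √(1 - height X) := Real.sqrt_pos.2 (by linarith [height_lt_one hX])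
  refine ⟨√(1 - height X), height_strictAntiOn.injOn (angle_mem_Ioo_of_pos hpos) hX ?_⟩
  rw [height_angle hpos, Real.sq_sqrt (Real.sqrt_pos.1 hpos).le, sub_sub_cancel]

theorem exists_angle_eq {X : ℝ} (hX : |X| < π) : ∃ τ, angle τ = X := by
  rw [abs_lt] at hX
  rcases lt_trichotomy X 0 with h | rfl | h
  · obtain ⟨τ, hτ⟩ := exists_angle_eq_of_pos (X := -X) ⟨by linarith, by linarith⟩
    exact ⟨-τ, by rw [angle_neg, hτ, neg_neg]⟩
  · exact ⟨0, angle_zero⟩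
  · exact exists_angle_eq_of_pos ⟨h, hX.2⟩

theorem angle_strictMonoOn : StrictMonoOn angle (Set.Ici 0) := by
  intro a ha b _ hab
  have hb0 : 0 < b := (Set.mem_Ici.1 ha).trans_lt hab
  rcases (Set.mem_Ici.1 ha).eq_or_lt with rfl | ha0
  · rw [angle_zero]
    exact (angle_mem_Ioo_of_pos hb0).1
  · refine (height_strictAntiOn.lt_iff_gt (angle_mem_Ioo_of_pos hb0)
      (angle_mem_Ioo_of_pos ha0)).1 ?_
    rw [height_angle ha0, height_angle hb0]
    gcongr

theorem angle_strictMono : StrictMono angle :=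
  strictMono_of_odd_strictMonoOn_nonneg angle_neg angle_strictMonoOn

theorem angle_nonneg {τ : ℝ} (hτ : 0 ≤ τ) : 0 ≤ angle τ :=
  angle_zero.symm.trans_le (angle_strictMono.monotone hτ)

theorem angle_ne_zero {τ : ℝ} (hτ : τ ≠ 0) : angle τ ≠ 0 := fun h =>
  hτ (angle_strictMono.injective (h.trans angle_zero.symm))

theorem angle_lt_pi (τ : ℝ) : angle τ < π :=
  (angle_strictMono.monotone (le_max_left τ 1)).trans_lt
    (angle_mem_Ioo_of_pos (lt_max_of_lt_right one_pos)).2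

theorem abs_angle_lt_pi (τ : ℝ) : |angle τ| < π :=
  abs_lt.2 ⟨by linarith [angle_lt_pi (-τ), angle_neg τ], angle_lt_pi τ⟩

theorem continuous_angle : Continuous angle := by
  refine continuous_iff_continuousAt.2 fun τ => continuousAt_of_monotoneOn_of_image_mem_nhds
    (s := Set.univ) (angle_strictMono.monotone.monotoneOn _) univ_mem ?_
  refine mem_of_superset (Ioo_mem_nhds (abs_lt.1 (abs_angle_lt_pi τ)).1 (angle_lt_pi τ))
    fun y hy => ?_
  obtain ⟨t, ht⟩ := exists_angle_eq (abs_lt.2 hy)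
  exact ⟨t, Set.mem_univ _, ht⟩

theorem sinc_pos_of_abs_lt_pi {y : ℝ} (hy : |y| < π) : 0 < Real.sinc y := by
  have hpos : ∀ y : ℝ, 0 < y → y < π → 0 < Real.sinc y := fun y h0 hpi => by
    rw [Real.sinc_of_ne_zero h0.ne']
    exact div_pos (Real.sin_pos_of_pos_of_lt_pi h0 hpi) h0
  rcases lt_trichotomy y 0 with h | rfl | h
  · rw [← Real.sinc_neg]
    exact hpos _ (neg_pos.2 h) (by linarith [(abs_lt.1 hy).1])
  · rw [Real.sinc_zero]
    exact one_pos
  · exact hpos _ h (abs_lt.1 hy).2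

theorem sinc_angle_pos (τ : ℝ) : 0 < Real.sinc (angle τ) :=
  sinc_pos_of_abs_lt_pi (abs_angle_lt_pi τ)

theorem theta_im (τ : ℝ) : (theta τ).im = Real.log (Real.sinc (angle τ)) := by
  have hpos : ∀ t : ℝ, 0 < t → (theta t).im = Real.log (Real.sinc (angle t)) := fun t ht => by
    obtain ⟨h0, hpi⟩ := angle_mem_Ioo_of_pos ht
    rw [((mem_Omega_and_eq_iff t (theta t)).1 (theta_spec ht)).2.2.1, Real.sinc_of_ne_zero h0.ne',
      Real.log_div (Real.sin_pos_of_pos_of_lt_pi h0 hpi).ne' h0.ne', angle]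
  rcases lt_trichotomy τ 0 with h | rfl | h
  · have himage := hpos (-τ) (neg_pos.2 h)
    rwa [theta_neg, angle_neg, Real.sinc_neg, Complex.neg_im, Complex.conj_im, neg_neg] at himage
  · rw [theta_zero, angle_zero, Real.sinc_zero, Real.log_one, Complex.zero_im]
  · exact hpos τ h

theorem theta_eq (τ : ℝ) :
    theta τ = (angle τ : ℂ) + (Real.log (Real.sinc (angle τ)) : ℂ) * I := by
  rw [← theta_im, angle, Complex.re_add_im]

theorem continuous_theta : Continuous theta := by
  rw [funext theta_eq]
  have hlog : Continuous fun τ => Real.log (Real.sinc (angle τ)) :=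
    (Real.continuous_sinc.comp continuous_angle).log fun τ => (sinc_angle_pos τ).ne'
  have hangle := continuous_angle
  fun_prop

theorem continuous_curve : Continuous curve :=
  (continuous_const.mul continuous_theta).cexp

theorem norm_curve (τ : ℝ) : ‖curve τ‖ = Real.exp (-(theta τ).im) := by
  rw [curve, Complex.norm_exp, Complex.I_mul_re]

theorem curve_re_eq (τ : ℝ) : (curve τ).re = Real.cos (angle τ) / Real.sinc (angle τ) := by
  rw [curve, Complex.exp_re, Complex.I_mul_re, Complex.I_mul_im, theta_im, Real.exp_neg,
    Real.exp_log (sinc_angle_pos τ), ← angle]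
  ring

theorem one_le_norm_curve (τ : ℝ) : 1 ≤ ‖curve τ‖ := by
  rw [norm_curve, theta_im, Real.one_le_exp_iff, neg_nonneg]
  exact Real.log_nonpos (sinc_angle_pos τ).le (Real.sinc_le_one _)

theorem curve_sub_one_ne_zero {τ : ℝ} (hτ : τ ≠ 0) : curve τ - 1 ≠ 0 := fun h =>
  angle_ne_zero hτ (by rw [← curve_im, sub_eq_zero.1 h, Complex.one_im])

theorem curve_injective : Function.Injective curve := fun a b h =>
  angle_strictMono.injective (by rw [← curve_im, ← curve_im, h])

end SteepestDescentCurve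

section DerivativeOfTheCurve

theorem differentiableAt_angle_of_pos {τ : ℝ} (hτ : 0 < τ) : DifferentiableAt ℝ angle τ := by
  obtain ⟨h0, hpi⟩ := angle_mem_Ioo_of_pos hτ
  have hsin : 0 < Real.sin (angle τ) := Real.sin_pos_of_pos_of_lt_pi h0 hpi
  have hroot : 0 < 1 - height (angle τ) := sub_pos.2 (height_lt_one ⟨h0, hpi⟩)
  have hinverse := ((hasDerivAt_height h0 hpi).const_sub 1).sqrt hroot.ne'
  refine (HasDerivAt.of_local_left_inverse continuous_angle.continuousAt hinverse ?_
    ?_).differentiableAt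
  · rw [neg_neg]
    positivity
  · filter_upwards [lt_mem_nhds hτ] with t ht
    rw [height_angle ht, sub_sub_cancel, Real.sqrt_sq ht.le]

theorem differentiableAt_angle {τ : ℝ} (hτ : τ ≠ 0) : DifferentiableAt ℝ angle τ := by
  rcases lt_or_gt_of_ne hτ with h | h
  · have hodd : angle = fun t => -angle (-t) := funext fun t => by rw [angle_neg, neg_neg]
    rw [hodd]
    exact ((differentiableAt_angle_of_pos (neg_pos.2 h)).comp τ differentiableAt_id.neg).neg
  · exact differentiableAt_angle_of_pos h

theorem differentiableAt_theta {τ : ℝ} (hτ : τ ≠ 0) : DifferentiableAt ℝ theta τ := by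
  have hangle := differentiableAt_angle hτ
  have hne := angle_ne_zero hτ
  have hsinc : DifferentiableAt ℝ Real.sinc (angle τ) := by
    refine (Real.differentiableAt_sin.div differentiableAt_id hne).congr_of_eventuallyEq ?_
    filter_upwards [isOpen_ne.mem_nhds hne] with y hy
    exact Real.sinc_of_ne_zero hy
  have hlog : DifferentiableAt ℝ (fun t => Real.log (Real.sinc (angle t))) τ :=
    (hsinc.comp τ hangle).log (sinc_angle_pos τ).ne'
  rw [funext theta_eq]
  exact (hangle.hasDerivAt.ofReal_comp.add
    (hlog.hasDerivAt.ofReal_comp.mul_const I)).differentiableAt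

/-- The derivative of `theta`. Differentiating `e^{iθ} - iθ = 1 - τ²` determines it for `τ ≠ 0`;
the value at the saddle point `τ = 0` is the limit. -/
noncomputable def thetaDeriv (τ : ℝ) : ℂ :=
  if τ = 0 then (√2 : ℝ) else 2 * I * τ / (curve τ - 1)

theorem hasDerivAt_theta_of_ne {τ : ℝ} (hτ : τ ≠ 0) : HasDerivAt theta (thetaDeriv τ) τ := by
  have hd := (differentiableAt_theta hτ).hasDerivAt
  have hleft : HasDerivAt (fun t : ℝ => curve t - I * theta t)
      (curve τ * (I * deriv theta τ) - I * deriv theta τ) τ :=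
    ((hd.const_mul I).cexp).sub (hd.const_mul I)
  have hright : HasDerivAt (fun t : ℝ => (1 : ℂ) - (t : ℂ) ^ 2) (-(2 * τ)) τ := by
    simpa using ((hasDerivAt_id τ).ofReal_comp.pow 2).const_sub (1 : ℂ)
  rw [← funext curve_sub_I_mul_theta] at hright
  refine hd.congr_deriv ?_
  rw [thetaDeriv, if_neg hτ, eq_div_iff (curve_sub_one_ne_zero hτ)]
  linear_combination -I * hleft.unique hright + deriv theta τ * (curve τ - 1) * Complex.I_mul_I

theorem re_thetaDeriv_pos (τ : ℝ) : 0 < (thetaDeriv τ).re := by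
  rw [thetaDeriv]
  split_ifs with hτ
  · rw [Complex.ofReal_re]
    positivity
  · have hmul : 0 < τ * angle τ := by
      rcases lt_or_gt_of_ne hτ with h | h
      · exact mul_pos_of_neg_of_neg h (angle_zero ▸ angle_strictMono h)
      · exact mul_pos h (angle_mem_Ioo_of_pos h).1
    have hnorm : 0 < Complex.normSq (curve τ - 1) :=
      Complex.normSq_pos.2 (curve_sub_one_ne_zero hτ)
    have hre : (2 * I * τ / (curve τ - 1)).re =
        2 * (τ * angle τ) / Complex.normSq (curve τ - 1) := by
      rw [Complex.div_re]
      simp [curve_im, mul_assoc]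
    rw [hre]
    positivity

theorem tendsto_sq_thetaDeriv_zero : Tendsto (fun τ : ℝ => thetaDeriv τ ^ 2) (𝓝[≠] 0) (𝓝 2) := by
  have hcont : Continuous fun τ : ℝ => I * theta τ := continuous_const.mul continuous_theta
  have htheta : Tendsto (fun τ : ℝ => I * theta τ) (𝓝[≠] 0) (𝓝[≠] 0) := by
    refine tendsto_nhdsWithin_iff.2 ⟨?_, ?_⟩
    · exact (hcont.tendsto' 0 0 (by rw [theta_zero, mul_zero])).mono_left nhdsWithin_le_nhds
    · filter_upwards [self_mem_nhdsWithin] with τ hτ h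
      have htheta0 : theta τ = 0 := (mul_eq_zero.1 h).resolve_left Complex.I_ne_zero
      exact angle_ne_zero hτ (by rw [angle, htheta0, Complex.zero_re])
  have hlim := (tendsto_exp_sub_one_sub_id_div_exp_sub_one_sq.comp htheta).const_mul (4 : ℂ)
  rw [show (4 : ℂ) * (1 / 2) = 2 by norm_num] at hlim
  refine hlim.congr' ?_
  filter_upwards [self_mem_nhdsWithin] with τ (hτ : τ ≠ 0)
  rw [thetaDeriv, if_neg hτ, div_pow, Function.comp, ← curve, ← mul_div_assoc]
  congr 1
  linear_combination 4 * curve_sub_I_mul_theta τ - 4 * (τ : ℂ) ^ 2 * Complex.I_sq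

/- The square of `thetaDeriv` tends to `2`, and the positivity of the real part selects the root. -/
theorem continuousAt_thetaDeriv_zero : ContinuousAt thetaDeriv 0 := by
  rw [continuousAt_iff_punctured_nhds, thetaDeriv, if_pos rfl]
  have hsq := tendsto_sq_thetaDeriv_zero
  rw [tendsto_iff_norm_sub_tendsto_zero] at hsq ⊢
  refine squeeze_zero (fun _ => norm_nonneg _) (fun τ => ?_) hsq
  have hroot : ((√2 : ℝ) : ℂ) ^ 2 = 2 := by
    rw [← Complex.ofReal_pow, Real.sq_sqrt zero_le_two, Complex.ofReal_ofNat]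
  have hfactor : thetaDeriv τ ^ 2 - 2 = (thetaDeriv τ - (√2 : ℝ)) * (thetaDeriv τ + (√2 : ℝ)) := by
    linear_combination hroot
  have hsum : 1 ≤ ‖thetaDeriv τ + (√2 : ℝ)‖ := by
    refine le_trans ?_ (Complex.re_le_norm _)
    rw [Complex.add_re, Complex.ofReal_re]
    linarith [re_thetaDeriv_pos τ, Real.one_le_sqrt.2 (one_le_two : (1 : ℝ) ≤ 2)]
  rw [hfactor, norm_mul]
  exact le_mul_of_one_le_right (norm_nonneg _) hsum

theorem hasDerivAt_theta (τ : ℝ) : HasDerivAt theta (thetaDeriv τ) τ :=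
  hasDerivAt_of_hasDerivAt_of_ne' (fun _ h => hasDerivAt_theta_of_ne h)
    continuous_theta.continuousAt continuousAt_thetaDeriv_zero τ

theorem continuous_thetaDeriv : Continuous thetaDeriv := by
  refine continuous_iff_continuousAt.2 fun τ => ?_
  rcases eq_or_ne τ 0 with rfl | hτ
  · exact continuousAt_thetaDeriv_zero
  · have hcurve := continuous_curve
    have hquot : ContinuousAt (fun t : ℝ => 2 * I * (t : ℂ) / (curve t - 1)) τ :=
      ContinuousAt.div (by fun_prop) (by fun_prop) (curve_sub_one_ne_zero hτ)
    refine hquot.congr ?_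
    filter_upwards [isOpen_ne.mem_nhds hτ] with t ht
    rw [thetaDeriv, if_neg ht]

/-- The derivative of `curve`. -/
noncomputable def curveDeriv (τ : ℝ) : ℂ := I * thetaDeriv τ * curve τ

theorem hasDerivAt_curve (τ : ℝ) : HasDerivAt curve (curveDeriv τ) τ := by
  refine ((hasDerivAt_theta τ).const_mul I).cexp.congr_deriv ?_
  rw [curveDeriv, curve, mul_comm]

theorem continuous_curveDeriv : Continuous curveDeriv :=
  (continuous_const.mul continuous_thetaDeriv).mul continuous_curve

theorem curveDeriv_im (τ : ℝ) : (curveDeriv τ).im = (thetaDeriv τ).re := by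
  have him : HasDerivAt (fun t => (curve t).im) (curveDeriv τ).im τ :=
    Complex.imCLM.hasFDerivAt.comp_hasDerivAt τ (hasDerivAt_curve τ)
  rw [funext curve_im] at him
  exact him.unique (Complex.reCLM.hasFDerivAt.comp_hasDerivAt τ (hasDerivAt_theta τ))

theorem im_curveDeriv_pos (τ : ℝ) : 0 < (curveDeriv τ).im :=
  (curveDeriv_im τ).symm ▸ re_thetaDeriv_pos τ

end DerivativeOfTheCurve

section RealPartOfTheCurve

theorem curve_re_neg (τ : ℝ) : (curve (-τ)).re = (curve τ).re := by
  rw [curve_neg, Complex.conj_re]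

theorem curve_re_abs (τ : ℝ) : (curve |τ|).re = (curve τ).re := by
  rcases abs_choice τ with h | h <;> rw [h]
  exact curve_re_neg τ

theorem re_div_sub_one_pos {w : ℂ} (hw : 1 ≤ ‖w‖) (him : 0 < w.im) : 0 < (w / (w - 1)).re := by
  have hsq : 1 ≤ w.re ^ 2 + w.im ^ 2 := by
    have h := Complex.sq_norm w
    rw [Complex.normSq_apply] at h
    nlinarith
  have hne : w - 1 ≠ 0 := fun h => him.ne' (by rw [sub_eq_zero.1 h, Complex.one_im])
  have hre : (w / (w - 1)).re = (w.re ^ 2 + w.im ^ 2 - w.re) / Complex.normSq (w - 1) := by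
    rw [Complex.div_re, Complex.sub_re, Complex.sub_im, Complex.one_re, Complex.one_im]
    ring
  rw [hre]
  exact div_pos (by nlinarith [sq_nonneg (w.re - 1)]) (Complex.normSq_pos.2 hne)

theorem curve_re_strictAntiOn : StrictAntiOn (fun τ => (curve τ).re) (Set.Ici 0) := by
  have hd : ∀ τ, HasDerivAt (fun t => (curve t).re) (curveDeriv τ).re τ := fun τ =>
    Complex.reCLM.hasFDerivAt.comp_hasDerivAt τ (hasDerivAt_curve τ)
  refine strictAntiOn_of_deriv_neg (convex_Ici _)
    (fun τ _ => (hd τ).continuousAt.continuousWithinAt) fun τ hτ => ?_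
  rw [interior_Ici] at hτ
  have h0 : 0 < τ := hτ
  have hcurveDeriv : curveDeriv τ = ((-2 * τ : ℝ) : ℂ) * (curve τ / (curve τ - 1)) := by
    rw [curveDeriv, thetaDeriv, if_neg h0.ne']
    push_cast
    linear_combination 2 * (τ : ℂ) * curve τ / (curve τ - 1) * Complex.I_mul_I
  have hpos : 0 < (curve τ / (curve τ - 1)).re := by
    refine re_div_sub_one_pos (one_le_norm_curve τ) ?_
    rw [curve_im]
    exact (angle_mem_Ioo_of_pos h0).1
  rw [(hd τ).deriv, hcurveDeriv, Complex.re_ofReal_mul]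
  nlinarith

theorem curve_re_lt_curve_re_iff {σ T : ℝ} (hT : 0 ≤ T) :
    (curve T).re < (curve σ).re ↔ |σ| < T := by
  rw [← curve_re_abs σ]
  exact curve_re_strictAntiOn.lt_iff_gt hT (abs_nonneg σ)

theorem curve_re_le_curve_re_iff {σ T : ℝ} (hT : 0 ≤ T) :
    (curve T).re ≤ (curve σ).re ↔ |σ| ≤ T := by
  rw [← curve_re_abs σ]
  exact curve_re_strictAntiOn.le_iff_ge hT (abs_nonneg σ)

theorem curve_re_le_one (τ : ℝ) : (curve τ).re ≤ 1 := by
  have h := (curve_re_le_curve_re_iff (σ := 0) (abs_nonneg τ)).2 (abs_zero.trans_le (abs_nonneg τ))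
  rwa [curve_re_abs, curve_zero, Complex.one_re] at h

theorem abs_curve_im_lt_pi (τ : ℝ) : |(curve τ).im| < π := by
  rw [curve_im]
  exact abs_angle_lt_pi τ

theorem sq_le_of_curve_re (τ : ℝ) : τ ^ 2 ≤ 1 + π + 2 * |(curve τ).re| := by
  have hre := congrArg Complex.re (curve_sub_I_mul_theta τ)
  rw [← Complex.ofReal_pow, ← Complex.ofReal_one, ← Complex.ofReal_sub, Complex.ofReal_re,
    Complex.sub_re, Complex.I_mul_re] at hre
  have htheta : -(theta τ).im ≤ ‖curve τ‖ := by
    rw [norm_curve]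
    linarith [Real.add_one_le_exp (-(theta τ).im)]
  linarith [Complex.norm_le_abs_re_add_abs_im (curve τ), abs_curve_im_lt_pi τ,
    neg_abs_le (curve τ).re]

theorem tendsto_curve_re : Tendsto (fun τ => (curve τ).re) atTop atBot := by
  refine tendsto_atBot.2 fun b => ?_
  have hsq : Tendsto (fun τ : ℝ => τ ^ 2) atTop atTop := tendsto_pow_atTop two_ne_zero
  filter_upwards [hsq.eventually_gt_atTop (1 + π + 2 * (1 + |b|))] with τ hτ
  have hbound := sq_le_of_curve_re τ
  have hone := curve_re_le_one τ
  rcases abs_cases (curve τ).re with h | h <;> linarith [neg_abs_le b, abs_nonneg b]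

theorem curve_eq_re_add_angle_mul_I (τ : ℝ) : curve τ = (curve τ).re + (angle τ : ℝ) * I := by
  rw [← curve_im, Complex.re_add_im]

end RealPartOfTheCurve

section Integrand

theorem abs_re_div_ge (w x : ℂ) :
    (|w.re| * |x.re| - |w.im| * |x.im|) / Complex.normSq x ≤ |(w / x).re| := by
  rw [Complex.div_re, ← add_div, abs_div, abs_of_nonneg (Complex.normSq_nonneg x), ← abs_mul,
    ← abs_mul, ← abs_neg (w.im * x.im), ← sub_neg_eq_add]
  exact div_le_div_of_nonneg_right (abs_sub_abs_le_abs_sub _ _) (Complex.normSq_nonneg x)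

theorem exists_forall_le_abs_re_div {x : ℂ} (hx : x.re ≠ 0) (B M : ℝ) :
    ∃ R : ℝ, ∀ w : ℂ, w.re ≤ R → |w.im| ≤ B → M ≤ |(w / x).re| := by
  have hnormSq : 0 < Complex.normSq x :=
    Complex.normSq_pos.2 fun h => hx (by rw [h, Complex.zero_re])
  refine ⟨-((M * Complex.normSq x + B * |x.im|) / |x.re|), fun w hre him => ?_⟩
  refine le_trans ?_ (abs_re_div_ge w x)
  have hlarge := (div_le_iff₀ (abs_pos.2 hx)).1 ((le_neg.2 hre).trans (neg_le_abs w.re))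
  have hsmall : |w.im| * |x.im| ≤ B * |x.im| := by gcongr
  rw [le_div_iff₀ hnormSq]
  linarith

theorem tendsto_curve_re_cocompact : Tendsto (fun τ => (curve τ).re) (cocompact ℝ) atBot := by
  simpa only [Function.comp_def, Real.norm_eq_abs, curve_re_abs] using
    tendsto_curve_re.comp (tendsto_norm_cocompact_atTop (E := ℝ))

theorem abs_angle (τ : ℝ) : |angle τ| = angle |τ| := by
  rcases le_total 0 τ with h | h
  · rw [abs_of_nonneg h, abs_of_nonneg (angle_nonneg h)]
  · rw [abs_of_nonpos h, angle_neg, abs_of_nonpos]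
    exact angle_zero ▸ angle_strictMono.monotone h

theorem exists_pos_eventually_le_abs_re_curve_div {x : ℂ} (hx : x ≠ 0) :
    ∃ δ > 0, ∀ᶠ τ in cocompact ℝ, δ ≤ |(curve τ / x).re| := by
  by_cases hre : x.re = 0
  · have him : x.im ≠ 0 := fun him => hx (Complex.ext hre him)
    refine ⟨angle 1 * |x.im| / Complex.normSq x, div_pos (mul_pos
      (angle_mem_Ioo_of_pos one_pos).1 (abs_pos.2 him)) (Complex.normSq_pos.2 hx), ?_⟩
    filter_upwards [(tendsto_norm_cocompact_atTop (E := ℝ)).eventually_ge_atTop 1] with τ hτ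
    rw [Complex.div_re, hre, mul_zero, zero_div, zero_add, abs_div, abs_mul, curve_im, abs_angle,
      abs_of_nonneg (Complex.normSq_nonneg x)]
    exact div_le_div_of_nonneg_right (mul_le_mul_of_nonneg_right
      (angle_strictMono.monotone hτ) (abs_nonneg _)) (Complex.normSq_nonneg x)
  · obtain ⟨R, hR⟩ := exists_forall_le_abs_re_div hre π 1
    refine ⟨1, one_pos, (tendsto_curve_re_cocompact.eventually_le_atBot R).mono fun τ hτ => ?_⟩
    exact hR _ hτ (abs_curve_im_lt_pi τ).le

theorem exists_pos_eventually_le_norm_exp_curve_div_sub_one {x : ℂ} (hx : x ≠ 0) :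
    ∃ δ > 0, ∀ᶠ τ in cocompact ℝ, δ ≤ ‖Complex.exp (curve τ / x) - 1‖ := by
  obtain ⟨δ, hδ, h⟩ := exists_pos_eventually_le_abs_re_curve_div hx
  refine ⟨1 - Real.exp (-δ), sub_pos.2 (Real.exp_lt_one_iff.2 (neg_neg_of_pos hδ)), ?_⟩
  filter_upwards [h] with τ hτ
  refine le_trans ?_ (one_sub_exp_neg_abs_re_le_norm_exp_sub_one _)
  gcongr

/-- The zeros `2πikx`, `k ∈ ℤ`, of `w ↦ e^{w/x} - 1`, at which the integrand has its poles. -/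
noncomputable def pole (x : ℂ) (k : ℤ) : ℂ := 2 * π * I * k * x

theorem pole_zero (x : ℂ) : pole x 0 = 0 := by
  rw [pole, Int.cast_zero, mul_zero, zero_mul]

theorem pole_neg_left (x : ℂ) (k : ℤ) : pole (-x) k = pole x (-k) := by
  rw [pole, pole, Int.cast_neg]
  ring

theorem norm_pole (x : ℂ) (k : ℤ) : ‖pole x k‖ = 2 * π * ‖x‖ * ‖k‖ := by
  rw [pole, norm_mul, norm_mul, norm_mul, norm_mul, Complex.norm_two, Complex.norm_I,
    Complex.norm_real, Real.norm_of_nonneg Real.pi_nonneg, Complex.norm_intCast, Int.norm_eq_abs]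
  ring

variable {n : ℕ} {x : ℂ}

theorem exp_div_eq_one_iff (hx : x ≠ 0) {w : ℂ} :
    Complex.exp (w / x) = 1 ↔ ∃ k : ℤ, w = pole x k := by
  rw [Complex.exp_eq_one_iff]
  refine exists_congr fun k => ?_
  rw [div_eq_iff hx, pole]
  ring_nf

theorem pole_injective (hx : x ≠ 0) : Function.Injective (pole x) := fun k l h => by
  have hperiod : (2 * π * I : ℂ) ≠ 0 := Complex.two_pi_I_ne_zero
  exact Int.cast_injective (mul_left_cancel₀ hperiod (mul_right_cancel₀ hx h))

theorem finite_norm_pole_le (hx : x ≠ 0) (C : ℝ) : {k : ℤ | ‖pole x k‖ ≤ C}.Finite := by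
  have hpos : 0 < 2 * π * ‖x‖ := mul_pos Real.two_pi_pos (norm_pos_iff.2 hx)
  refine (isCompact_closedBall (0 : ℤ) (C / (2 * π * ‖x‖))).finite_of_discrete.subset fun k hk => ?_
  rw [Set.mem_ofPred_eq, norm_pole] at hk
  rwa [mem_closedBall_zero_iff, le_div_iff₀' hpos]

theorem g_div_of_ne_zero {w : ℂ} (hw : w ≠ 0) (hx : x ≠ 0) :
    g (w / x) = x * (Complex.exp (w / x) - 1) / w := by
  rw [g, if_neg (div_ne_zero hw hx), div_div_eq_mul_div, mul_comm]

theorem mem_singularSet_iff (hx : x ≠ 0) {τ : ℝ} :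
    τ ∈ singularSet x ↔ Complex.exp (curve τ / x) = 1 := by
  rw [singularSet, Set.mem_ofPred_eq, ← curve, g_div_of_ne_zero (curve_ne_zero τ) hx,
    div_eq_zero_iff, or_iff_left (curve_ne_zero τ), mul_eq_zero, or_iff_right hx, sub_eq_zero]

theorem finite_singularSet (hx : x ≠ 0) : (singularSet x).Finite := by
  obtain ⟨δ, hδ, hfar⟩ := exists_pos_eventually_le_norm_exp_curve_div_sub_one hx
  obtain ⟨K, hK, hsub⟩ := mem_cocompact'.1 hfar
  obtain ⟨C, hC⟩ := hK.exists_bound_of_continuousOn continuous_curve.continuousOn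
  refine (((finite_norm_pole_le hx C).image (pole x)).preimage curve_injective.injOn).subset
    fun τ hτ => ?_
  have hexp : Complex.exp (curve τ / x) = 1 := (mem_singularSet_iff hx).1 hτ
  obtain ⟨k, hk⟩ := (exp_div_eq_one_iff hx).1 hexp
  refine ⟨k, ?_, hk.symm⟩
  rw [Set.mem_ofPred_eq, ← hk]
  refine hC τ (hsub ?_)
  rw [Set.mem_compl_iff, Set.mem_ofPred_eq, hexp, sub_self, norm_zero]
  exact hδ.not_ge

/-- The meromorphic function `e^{nw} / (w^{n+1} g(w/x))` of which the principal value integral is,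
up to the factor `-i e^{-n}`, the contour integral along `curve`. -/
noncomputable def kernel (n : ℕ) (x w : ℂ) : ℂ :=
  Complex.exp (n * w) / (w ^ n * (x * (Complex.exp (w / x) - 1)))

theorem exp_neg_mul_sq_eq (n : ℕ) (τ : ℝ) :
    Complex.exp (-(n : ℂ) * (τ : ℂ) ^ 2) =
      Complex.exp (-n) * Complex.exp (n * curve τ) / curve τ ^ n := by
  have hpow : curve τ ^ n = Complex.exp (n * (I * theta τ)) := by
    rw [curve, ← Complex.exp_nat_mul]
  rw [hpow, ← Complex.exp_add, ← Complex.exp_sub]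
  congr 1
  linear_combination (-(n : ℂ)) * curve_sub_I_mul_theta τ

theorem integrand_eq (hx : x ≠ 0) (τ : ℝ) :
    integrand n x τ = Complex.exp (-n) / I * (kernel n x (curve τ) * curveDeriv τ) := by
  have hcurve := curve_ne_zero τ
  rw [integrand, exp_neg_mul_sq_eq, (hasDerivAt_theta τ).deriv, ← curve,
    g_div_of_ne_zero hcurve hx, kernel, curveDeriv]
  by_cases h : Complex.exp (curve τ / x) - 1 = 0
  · simp only [h, mul_zero, zero_div, div_zero, zero_mul]
  · field_simp

theorem differentiableAt_kernel (hx : x ≠ 0) {w : ℂ} (hw : w ≠ 0)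
    (h : Complex.exp (w / x) ≠ 1) : DifferentiableAt ℂ (kernel n x) w := by
  unfold kernel
  refine DifferentiableAt.fun_div (by fun_prop) (by fun_prop) ?_
  exact mul_ne_zero (pow_ne_zero _ hw) (mul_ne_zero hx (sub_ne_zero.2 h))

theorem continuousOn_integrand (hx : x ≠ 0) : ContinuousOn (integrand n x) (singularSet x)ᶜ := by
  intro τ hτ
  rw [Set.mem_compl_iff, mem_singularSet_iff hx] at hτ
  rw [funext (integrand_eq (n := n) hx)]
  have hkernel := (differentiableAt_kernel (n := n) hx (curve_ne_zero τ) hτ).continuousAt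
  exact (continuousAt_const.mul ((hkernel.comp continuous_curve.continuousAt).mul
    continuous_curveDeriv.continuousAt)).continuousWithinAt

theorem isBigO_curve_div_curve_sub_one :
    (fun τ => curve τ / (curve τ - 1)) =O[cocompact ℝ] fun _ => (1 : ℝ) := by
  refine IsBigO.of_bound 2 ?_
  filter_upwards [tendsto_curve_re_cocompact.eventually_le_atBot 0] with τ hτ
  have hfar : 1 ≤ ‖curve τ - 1‖ := by
    refine le_trans ?_ (Complex.abs_re_le_norm _)
    rw [Complex.sub_re, Complex.one_re]
    linarith [neg_le_abs ((curve τ).re - 1)]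
  have htriangle := norm_sub_norm_le (curve τ) 1
  rw [norm_one] at htriangle
  rw [norm_div, norm_one, mul_one, div_le_iff₀ (one_pos.trans_le hfar)]
  linarith

theorem isBigO_inv_exp_curve_div_sub_one (hx : x ≠ 0) :
    (fun τ => (Complex.exp (curve τ / x) - 1)⁻¹) =O[cocompact ℝ] fun _ => (1 : ℝ) := by
  obtain ⟨δ, hδ, h⟩ := exists_pos_eventually_le_norm_exp_curve_div_sub_one hx
  refine IsBigO.of_bound δ⁻¹ (h.mono fun τ hτ => ?_)
  rw [norm_inv, norm_one, mul_one]
  exact inv_anti₀ hδ hτ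

theorem norm_exp_neg_mul_sq_le (hn : 1 ≤ n) (τ : ℝ) :
    ‖Complex.exp (-(n : ℂ) * (τ : ℂ) ^ 2)‖ ≤ Real.exp (-τ ^ 2) := by
  have hreal : -(n : ℂ) * (τ : ℂ) ^ 2 = ((-(n * τ ^ 2) : ℝ) : ℂ) := by push_cast; ring
  rw [hreal, Complex.norm_exp, Complex.ofReal_re, Real.exp_le_exp, neg_le_neg_iff]
  exact le_mul_of_one_le_left (sq_nonneg τ) (mod_cast hn)

theorem isBigO_integrand (hn : 1 ≤ n) (hx : x ≠ 0) :
    integrand n x =O[cocompact ℝ] fun τ => τ * Real.exp (-τ ^ 2) := by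
  have hgauss : (fun τ : ℝ => (τ : ℂ) * Complex.exp (-(n : ℂ) * (τ : ℂ) ^ 2)) =O[cocompact ℝ]
      fun τ => τ * Real.exp (-τ ^ 2) := by
    refine isBigO_of_le _ fun τ => ?_
    rw [norm_mul, norm_mul, Complex.norm_real, Real.norm_of_nonneg (Real.exp_nonneg _)]
    exact mul_le_mul_of_nonneg_left (norm_exp_neg_mul_sq_le hn τ) (norm_nonneg _)
  have hproduct := ((hgauss.mul isBigO_curve_div_curve_sub_one).mul
    (isBigO_inv_exp_curve_div_sub_one hx)).const_mul_left (2 * I / x)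
  refine hproduct.congr' ?_ (Eventually.of_forall fun τ => by ring)
  have hne : ∀ᶠ τ : ℝ in cocompact ℝ, τ ≠ 0 := isCompact_singleton.compl_mem_cocompact
  filter_upwards [hne] with τ hτ
  have hcurve := curve_sub_one_ne_zero hτ
  rw [integrand, (hasDerivAt_theta τ).deriv, ← curve, g_div_of_ne_zero (curve_ne_zero τ) hx,
    thetaDeriv, if_neg hτ]
  by_cases h : Complex.exp (curve τ / x) - 1 = 0
  · simp only [h, mul_zero, zero_div, div_zero, inv_zero]
  · field_simp

theorem exists_integrableOn_integrand_compl_Icc (hn : 1 ≤ n) (hx : x ≠ 0) :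
    ∃ T : ℝ, IntegrableOn (integrand n x) (Set.Icc (-T) T)ᶜ := by
  have hS := finite_singularSet hx
  have hmeasurable : StronglyMeasurableAtFilter (integrand n x) (cocompact ℝ) :=
    ⟨_, hS.isCompact.compl_mem_cocompact,
      (continuousOn_integrand hx).aestronglyMeasurable hS.measurableSet.compl⟩
  have hgauss : Integrable fun τ : ℝ => τ * Real.exp (-τ ^ 2) := by
    simpa only [neg_mul, one_mul] using integrable_mul_exp_neg_mul_sq one_pos
  obtain ⟨K, hK, hint⟩ :=
    (isBigO_integrand hn hx).integrableAtFilter hmeasurable (hgauss.integrableAtFilter _)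
  obtain ⟨T, hT⟩ := Metric.closedBall_compl_subset_of_mem_cocompact hK 0
  refine ⟨T, hint.mono_set ?_⟩
  rwa [Real.closedBall_eq_Icc, zero_sub, zero_add] at hT

theorem integrableOn_integrand_awayFrom (hn : 1 ≤ n) (hx : x ≠ 0) {ε : ℝ} (hε : 0 < ε) :
    IntegrableOn (integrand n x) (awayFrom (singularSet x) ε) := by
  obtain ⟨T, hT⟩ := exists_integrableOn_integrand_compl_Icc hn hx
  have hcompact : IntegrableOn (integrand n x) (awayFrom (singularSet x) ε ∩ Set.Icc (-T) T) :=
    integrableOn_awayFrom_inter_Icc hε ((continuousOn_integrand hx).mono fun τ hτ => hτ.2)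
  refine (hcompact.union hT).mono_set fun τ hτ => ?_
  by_cases h : τ ∈ Set.Icc (-T) T
  · exact Or.inl ⟨hτ, h⟩
  · exact Or.inr h

end Integrand

section ContourComparison

/-- The vertical chord from `curve (-T)` to `curve T`, parametrized by its imaginary part. -/
noncomputable def chord (T y : ℝ) : ℂ := (curve T).re + y * I

theorem chord_re (T y : ℝ) : (chord T y).re = (curve T).re := by
  simp [chord]

theorem chord_im (T y : ℝ) : (chord T y).im = y := by
  simp [chord]

theorem chord_angle (T : ℝ) : chord T (angle T) = curve T :=
  (curve_eq_re_add_angle_mul_I T).symm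

theorem chord_neg_angle (T : ℝ) : chord T (-angle T) = curve (-T) := by
  rw [curve_eq_re_add_angle_mul_I, curve_re_neg, angle_neg, chord]

theorem abs_lt_pi_of_mem_uIcc_angle {T y : ℝ} (hy : y ∈ Set.uIcc (-angle T) (angle T)) :
    |y| < π := by
  obtain ⟨hlower, hupper⟩ := abs_lt.1 (abs_angle_lt_pi T)
  exact abs_lt.2 (Set.ordConnected_Ioo.uIcc_subset ⟨by linarith, by linarith⟩
    ⟨hlower, hupper⟩ hy)

theorem hasDerivAt_chord (T y : ℝ) : HasDerivAt (chord T) I y :=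
  (((hasDerivAt_id' y).ofReal_comp.mul_const I).const_add ((curve T).re : ℂ)).congr_deriv
    (by rw [Complex.ofReal_one, one_mul])

theorem continuous_chord (T : ℝ) : Continuous (chord T) :=
  continuous_iff_continuousAt.2 fun y => (hasDerivAt_chord T y).continuousAt

theorem integral_curve_eq_sub {f F : ℂ → ℂ} {U : Set ℂ} {a b : ℝ}
    (hF : ∀ w ∈ U, HasDerivAt F (f w) w) (hf : ContinuousOn f U)
    (hU : Set.MapsTo curve (Set.uIcc a b) U) :
    ∫ τ in a..b, f (curve τ) * curveDeriv τ = F (curve b) - F (curve a) :=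
  intervalIntegral.integral_eq_sub_of_hasDerivAt (f := F ∘ curve)
    (fun τ hτ => (hF _ (hU hτ)).comp τ (hasDerivAt_curve τ))
    ((hf.comp continuous_curve.continuousOn hU).mul
      continuous_curveDeriv.continuousOn).intervalIntegrable

theorem integral_chord_eq_sub {f F : ℂ → ℂ} {U : Set ℂ} {T a b : ℝ}
    (hF : ∀ w ∈ U, HasDerivAt F (f w) w) (hf : ContinuousOn f U)
    (hU : Set.MapsTo (chord T) (Set.uIcc a b) U) :
    ∫ y in a..b, f (chord T y) * I = F (chord T b) - F (chord T a) :=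
  intervalIntegral.integral_eq_sub_of_hasDerivAt (f := F ∘ chord T)
    (fun y hy => (hF _ (hU hy)).comp y (hasDerivAt_chord T y))
    ((hf.comp (continuous_chord T).continuousOn hU).mul continuousOn_const).intervalIntegrable

/-- `f` is continuous along `curve` between the parameters `-T` and `T`, except at those in `S`,
and along the chord joining the endpoints of this arc, and the principal value integral of `f`
along the arc exceeds its integral along the chord by `D`. -/
structure HasContourDiff (S : Set ℝ) (T : ℝ) (f : ℂ → ℂ) (D : ℂ) : Prop where
  continuousOn_curve : ContinuousOn (fun τ => f (curve τ)) (Set.Icc (-T) T \ S)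
  continuousOn_chord : ContinuousOn (fun y => f (chord T y)) (Set.uIcc (-angle T) (angle T))
  tendsto : Tendsto
    (fun ε : ℝ => ∫ τ in awayFrom S ε ∩ Set.Icc (-T) T, f (curve τ) * curveDeriv τ)
    (𝓝[>] 0) (𝓝 (D + ∫ y in -angle T..angle T, f (chord T y) * I))

namespace HasContourDiff

variable {S : Set ℝ} {T : ℝ} {f f' : ℂ → ℂ} {D D' : ℂ}

theorem integrableOn_curve (h : HasContourDiff S T f D) {ε : ℝ} (hε : 0 < ε) :
    IntegrableOn (fun τ => f (curve τ) * curveDeriv τ) (awayFrom S ε ∩ Set.Icc (-T) T) :=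
  integrableOn_awayFrom_inter_Icc hε (h.continuousOn_curve.mul continuous_curveDeriv.continuousOn)

theorem intervalIntegrable_chord (h : HasContourDiff S T f D) :
    IntervalIntegrable (fun y => f (chord T y) * I) volume (-angle T) (angle T) :=
  (h.continuousOn_chord.mul continuousOn_const).intervalIntegrable

theorem zero : HasContourDiff S T (fun _ => 0) 0 :=
  ⟨continuousOn_const, continuousOn_const, by simp⟩

theorem const_mul (h : HasContourDiff S T f D) (c : ℂ) :
    HasContourDiff S T (fun w => c * f w) (c * D) := by
  refine ⟨continuousOn_const.mul h.continuousOn_curve,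
    continuousOn_const.mul h.continuousOn_chord, ?_⟩
  simpa only [mul_assoc, integral_const_mul, intervalIntegral.integral_const_mul, mul_add]
    using h.tendsto.const_mul c

theorem add (h : HasContourDiff S T f D) (h' : HasContourDiff S T f' D') :
    HasContourDiff S T (fun w => f w + f' w) (D + D') := by
  refine ⟨h.continuousOn_curve.add h'.continuousOn_curve,
    h.continuousOn_chord.add h'.continuousOn_chord, ?_⟩
  simp only [add_mul]
  rw [intervalIntegral.integral_add h.intervalIntegrable_chord h'.intervalIntegrable_chord,
    add_add_add_comm]
  refine (h.tendsto.add h'.tendsto).congr' ?_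
  filter_upwards [self_mem_nhdsWithin] with ε (hε : 0 < ε)
  exact (integral_add (h.integrableOn_curve hε) (h'.integrableOn_curve hε)).symm

theorem sum {ι : Type*} {F : ι → ℂ → ℂ} {D : ι → ℂ} {K : Finset ι}
    (h : ∀ i ∈ K, HasContourDiff S T (F i) (D i)) :
    HasContourDiff S T (fun w => ∑ i ∈ K, F i w) (∑ i ∈ K, D i) := by
  classical
  induction K using Finset.induction_on with
  | empty => exact zero
  | insert i K hi ih =>
    simp only [Finset.sum_insert hi]
    exact (h i (Finset.mem_insert_self i K)).add
      (ih fun j hj => h j (Finset.mem_insert_of_mem hj))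

theorem congr (hS : S.Finite) (h : HasContourDiff S T f D)
    (hcurve : ∀ τ ∈ Set.Icc (-T) T, τ ∉ S → f' (curve τ) = f (curve τ))
    (hchord : ∀ y ∈ Set.uIcc (-angle T) (angle T), f' (chord T y) = f (chord T y)) :
    HasContourDiff S T f' D := by
  refine ⟨h.continuousOn_curve.congr fun τ hτ => hcurve τ hτ.1 hτ.2,
    h.continuousOn_chord.congr hchord, ?_⟩
  rw [intervalIntegral.integral_congr fun y hy => congrArg (· * I) (hchord y hy)]
  refine h.tendsto.congr' ?_
  filter_upwards [self_mem_nhdsWithin] with ε (hε : 0 < ε)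
  refine setIntegral_congr_fun ((measurableSet_awayFrom hS ε).inter measurableSet_Icc)
    fun τ hτ => congrArg (· * curveDeriv τ) (hcurve τ hτ.2 fun hτS => ?_).symm
  have hlt := hτ.1 τ hτS
  rw [sub_self, abs_zero] at hlt
  exact hε.not_gt hlt

theorem of_continuousOn (hS : S.Finite) (hT : 0 ≤ T)
    (hcurve : ContinuousOn (fun τ => f (curve τ)) (Set.Icc (-T) T))
    (hchord : ContinuousOn (fun y => f (chord T y)) (Set.uIcc (-angle T) (angle T))) :
    HasContourDiff S T f ((∫ τ in -T..T, f (curve τ) * curveDeriv τ) -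
      ∫ y in -angle T..angle T, f (chord T y) * I) := by
  refine ⟨hcurve.mono Set.sdiff_subset, hchord, ?_⟩
  rw [sub_add_cancel, intervalIntegral.integral_of_le (neg_le_self hT),
    ← integral_Icc_eq_integral_Ioc]
  exact tendsto_setIntegral_awayFrom_inter hS
    (hcurve.mul continuous_curveDeriv.continuousOn).integrableOn_Icc

theorem of_primitive (hS : S.Finite) (hT : 0 ≤ T) {F : ℂ → ℂ} {U : Set ℂ}
    (hF : ∀ w ∈ U, HasDerivAt F (f w) w) (hf : ContinuousOn f U)
    (hcurve : Set.MapsTo curve (Set.Icc (-T) T) U)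
    (hchord : Set.MapsTo (chord T) (Set.uIcc (-angle T) (angle T)) U) :
    HasContourDiff S T f 0 := by
  have h := of_continuousOn (f := f) hS hT (hf.comp continuous_curve.continuousOn hcurve)
    (hf.comp (continuous_chord T).continuousOn hchord)
  rwa [integral_chord_eq_sub hF hf hchord, integral_curve_eq_sub hF hf
    (by rwa [Set.uIcc_of_le (neg_le_self hT)]), chord_angle, chord_neg_angle, sub_self] at h

end HasContourDiff

/-- The weight with which a pole `a` lying to the right of all chords is counted: `1` inside the
curve, `1/2` on it and `0` outside. The curve is the graph of `y ↦ y cot y`, `|y| < π`, over the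
imaginary axis, the function being written as `cos y / sinc y` so as to include `y = 0`. -/
noncomputable def weight (a : ℂ) : ℝ :=
  if |a.im| < π then step (Real.cos a.im / Real.sinc a.im - a.re) else 0

/-- The weight of a pole `a` in the region between the curve and its chord at height `T`. -/
noncomputable def enclosedWeight (T : ℝ) (a : ℂ) : ℝ :=
  if (curve T).re < a.re then weight a else 0

theorem weight_of_angle_eq {a : ℂ} {σ : ℝ} (h : angle σ = a.im) :
    weight a = step ((curve σ).re - a.re) := by
  rw [weight, if_pos (h ▸ abs_angle_lt_pi σ), curve_re_eq, h]

theorem weight_of_pi_le_abs_im {a : ℂ} (h : π ≤ |a.im|) : weight a = 0 :=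
  if_neg h.not_gt

theorem step_of_pos {t : ℝ} (h : 0 < t) : step t = 1 := if_pos h

theorem step_zero : step 0 = 1 / 2 := by
  rw [step, if_neg (lt_irrefl 0), if_pos rfl]

theorem step_of_neg {t : ℝ} (h : t < 0) : step t = 0 := by
  rw [step, if_neg h.not_gt, if_neg h.ne]

variable {S : Set ℝ} {T : ℝ} {a : ℂ}

theorem continuousOn_inv_sub_of_sub_mem_slitPlane :
    ContinuousOn (fun w => (w - a)⁻¹) {w | w - a ∈ Complex.slitPlane} := fun _ hw =>
  (continuousAt_inv_sub (ne_of_sub_mem_slitPlane hw)).continuousWithinAt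

theorem continuousOn_inv_sub_of_const_sub_mem_slitPlane :
    ContinuousOn (fun w => (w - a)⁻¹) {w | a - w ∈ Complex.slitPlane} := fun _ hw =>
  (continuousAt_inv_sub (ne_of_sub_mem_slitPlane hw).symm).continuousWithinAt

theorem sub_chord_mem_slitPlane (h : (curve T).re < a.re) (y : ℝ) :
    a - chord T y ∈ Complex.slitPlane :=
  Or.inl (by rwa [Complex.sub_re, chord_re, sub_pos])

theorem hasContourDiff_inv_sub_of_right (hS : S.Finite) (hT : 0 ≤ T) (h : (curve T).re < a.re)
    (hout : ∀ τ, angle τ = a.im → (curve τ).re < a.re) :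
    HasContourDiff S T (fun w => (w - a)⁻¹) 0 := by
  refine .of_primitive hS hT (fun w hw => hasDerivAt_log_const_sub hw)
    continuousOn_inv_sub_of_const_sub_mem_slitPlane (fun τ _ => ?_)
    fun y _ => sub_chord_mem_slitPlane h y
  by_cases him : angle τ = a.im
  · exact Or.inl (by rw [Complex.sub_re]; exact sub_pos.2 (hout τ him))
  · exact Or.inr (by rw [Complex.sub_im, curve_im]; exact sub_ne_zero.2 (Ne.symm him))

theorem hasContourDiff_inv_sub_of_left (hS : S.Finite) (hT : 0 ≤ T) (h : a.re ≤ (curve T).re)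
    (ha : ∀ y ∈ Set.uIcc (-angle T) (angle T), chord T y ≠ a) :
    HasContourDiff S T (fun w => (w - a)⁻¹) 0 := by
  have hmem : ∀ w : ℂ, (curve T).re ≤ w.re → w.im ∈ Set.uIcc (-angle T) (angle T) →
      w - a ∈ Complex.slitPlane := fun w hre him => by
    rw [Complex.mem_slitPlane_iff]
    by_contra! hc
    rw [Complex.sub_re, Complex.sub_im, sub_eq_zero] at hc
    refine ha _ him (Complex.ext ?_ ?_)
    · rw [chord_re]
      linarith
    · rw [chord_im, hc.2]
  refine .of_primitive hS hT (fun w hw => hasDerivAt_log_sub hw)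
    continuousOn_inv_sub_of_sub_mem_slitPlane (fun τ hτ => hmem _ ?_ ?_)
    fun y hy => hmem _ (chord_re T y).ge ((chord_im T y).symm ▸ hy)
  · exact (curve_re_le_curve_re_iff hT).2 (abs_le.2 hτ)
  · rw [curve_im, ← angle_neg]
    exact Set.Icc_subset_uIcc ⟨angle_strictMono.monotone hτ.1, angle_strictMono.monotone hτ.2⟩

theorem integral_chord_inv_sub (h : (curve T).re < a.re) (him : |a.im| < angle T) :
    ∫ y in -angle T..angle T, (chord T y - a)⁻¹ * I =
      Complex.log (curve T - a) - Complex.log (curve (-T) - a) - 2 * π * I := by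
  rw [abs_lt] at him
  rw [integral_chord_eq_sub (f := fun w => (w - a)⁻¹) (fun w hw => hasDerivAt_log_const_sub hw)
    continuousOn_inv_sub_of_const_sub_mem_slitPlane fun y _ => sub_chord_mem_slitPlane h y,
    chord_angle, chord_neg_angle, ← neg_sub (curve T), ← neg_sub (curve (-T)), log_neg_of_im_pos,
    log_neg_of_im_neg]
  · ring
  · rw [Complex.sub_im, curve_im, angle_neg]
    linarith
  · rw [Complex.sub_im, curve_im]
    linarith

theorem abs_angle_lt_angle {σ : ℝ} (h : |σ| < T) : |angle σ| < angle T := by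
  rw [abs_angle]
  exact angle_strictMono h

theorem curve_sub_mem_slitPlane {σ : ℝ} (hσ : angle σ = a.im) {τ : ℝ} (h : τ ≠ σ) :
    curve τ - a ∈ Complex.slitPlane :=
  Or.inr (by
    rw [Complex.sub_im, curve_im, ← hσ]
    exact sub_ne_zero.2 (angle_strictMono.injective.ne h))

theorem hasContourDiff_inv_sub_of_inside (hS : S.Finite) (hT : 0 ≤ T) (h : (curve T).re < a.re)
    {σ : ℝ} (hσ : angle σ = a.im) (hin : a.re < (curve σ).re) :
    HasContourDiff S T (fun w => (w - a)⁻¹) (2 * π * I) := by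
  have hσT : |σ| < T := (curve_re_lt_curve_re_iff hT).1 (h.trans hin)
  have hcurve : ∀ τ, curve τ - a ∈ Complex.slitPlane := fun τ => by
    rcases eq_or_ne τ σ with rfl | hne
    · exact Or.inl (by rwa [Complex.sub_re, sub_pos])
    · exact curve_sub_mem_slitPlane hσ hne
  have hdiff := HasContourDiff.of_continuousOn (f := fun w => (w - a)⁻¹) hS hT
    (continuousOn_inv_sub_of_sub_mem_slitPlane.comp continuous_curve.continuousOn
      fun τ _ => hcurve τ)
    (continuousOn_inv_sub_of_const_sub_mem_slitPlane.comp (continuous_chord T).continuousOn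
      fun y _ => sub_chord_mem_slitPlane h y)
  rwa [integral_chord_inv_sub h (hσ ▸ abs_angle_lt_angle hσT), integral_curve_eq_sub
    (fun w hw => hasDerivAt_log_sub hw) continuousOn_inv_sub_of_sub_mem_slitPlane
    fun τ _ => hcurve τ, sub_sub_cancel] at hdiff

theorem setIntegral_awayFrom_singleton_inv_curve_sub {s ε : ℝ} (hε : 0 < ε) (ha : -T ≤ s - ε)
    (hb : s + ε ≤ T) :
    ∫ τ in awayFrom {s} ε ∩ Set.Icc (-T) T, (curve τ - curve s)⁻¹ * curveDeriv τ =
      Complex.log (curve (s - ε) - curve s) - Complex.log (curve (s + ε) - curve s) +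
        (Complex.log (curve T - curve s) - Complex.log (curve (-T) - curve s)) := by
  have hmem : ∀ τ, τ ≠ s → curve τ - curve s ∈ Complex.slitPlane := fun τ h =>
    curve_sub_mem_slitPlane (curve_im s).symm h
  have hcont := continuousOn_inv_sub_of_sub_mem_slitPlane (a := curve s)
  rw [setIntegral_awayFrom_singleton_inter_Icc (f := fun τ => (curve τ - curve s)⁻¹ * curveDeriv τ)
      hε ha hb ((hcont.comp continuous_curve.continuousOn fun τ hτ => hmem τ hτ.2).mul
        continuous_curveDeriv.continuousOn),
    integral_curve_eq_sub (fun w hw => hasDerivAt_log_sub hw) hcont fun τ hτ => hmem τ ?_,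
    integral_curve_eq_sub (fun w hw => hasDerivAt_log_sub hw) hcont fun τ hτ => hmem τ ?_]
  · ring
  · rw [Set.uIcc_of_le hb] at hτ
    linarith [hτ.1]
  · rw [Set.uIcc_of_le ha] at hτ
    linarith [hτ.2]

theorem hasContourDiff_inv_sub_curve (hS : S.Finite) {s : ℝ} (hs : s ∈ S) (hsT : |s| < T) :
    HasContourDiff S T (fun w => (w - curve s)⁻¹) (π * I) := by
  have hT : 0 ≤ T := (abs_nonneg s).trans hsT.le
  have hre : (curve T).re < (curve s).re := (curve_re_lt_curve_re_iff hT).2 hsT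
  have hcurve : ContinuousOn (fun τ => (curve τ - curve s)⁻¹) (Set.Icc (-T) T \ {s}) :=
    continuousOn_inv_sub_of_sub_mem_slitPlane.comp continuous_curve.continuousOn
      fun τ hτ => curve_sub_mem_slitPlane (curve_im s).symm hτ.2
  refine ⟨hcurve.mono (Set.sdiff_subset_sdiff_right (Set.singleton_subset_iff.2 hs)),
    continuousOn_inv_sub_of_const_sub_mem_slitPlane.comp (continuous_chord T).continuousOn
      fun y _ => sub_chord_mem_slitPlane hre y,
    tendsto_setIntegral_awayFrom_of_singleton hS hs
      (hcurve.mul continuous_curveDeriv.continuousOn) ?_⟩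
  rw [integral_chord_inv_sub hre (curve_im s ▸ abs_angle_lt_angle hsT)]
  have hlim := (tendsto_log_sub_log_of_hasDerivAt (hasDerivAt_curve s)
    (im_curveDeriv_pos s)).add_const
    (Complex.log (curve T - curve s) - Complex.log (curve (-T) - curve s))
  convert hlim.congr' ?_ using 2
  · ring
  filter_upwards [self_mem_nhdsWithin,
    (eventually_lt_nhds (sub_pos.2 hsT)).filter_mono nhdsWithin_le_nhds] with ε (hε : 0 < ε) hεT
  exact (setIntegral_awayFrom_singleton_inv_curve_sub hε (by linarith [neg_abs_le s])
    (by linarith [le_abs_self s])).symm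

theorem hasContourDiff_inv_sub (hS : S.Finite) (hT : 0 ≤ T)
    (ha : ∀ y ∈ Set.uIcc (-angle T) (angle T), chord T y ≠ a) (haS : ∀ s, curve s = a → s ∈ S) :
    HasContourDiff S T (fun w => (w - a)⁻¹) (2 * π * I * enclosedWeight T a) := by
  rw [enclosedWeight]
  split_ifs with h
  · rcases lt_or_ge |a.im| π with him | him
    · obtain ⟨σ, hσ⟩ := exists_angle_eq him
      rw [weight_of_angle_eq hσ]
      rcases lt_trichotomy a.re (curve σ).re with hin | hon | hout
      · rw [step_of_pos (sub_pos.2 hin), Complex.ofReal_one, mul_one]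
        exact hasContourDiff_inv_sub_of_inside hS hT h hσ hin
      · obtain rfl : curve σ = a := Complex.ext hon.symm (by rw [curve_im, hσ])
        convert hasContourDiff_inv_sub_curve hS (haS σ rfl)
          ((curve_re_lt_curve_re_iff hT).1 h) using 1
        rw [sub_self, step_zero]
        push_cast
        ring
      · rw [step_of_neg (sub_neg.2 hout), Complex.ofReal_zero, mul_zero]
        refine hasContourDiff_inv_sub_of_right hS hT h fun τ hτ => ?_
        rwa [angle_strictMono.injective (hτ.trans hσ.symm)]
    · rw [weight_of_pi_le_abs_im him, Complex.ofReal_zero, mul_zero]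
      exact hasContourDiff_inv_sub_of_right hS hT h fun τ hτ =>
        absurd (hτ ▸ abs_angle_lt_pi τ) him.not_gt
  · rw [Complex.ofReal_zero, mul_zero]
    exact hasContourDiff_inv_sub_of_left hS hT (not_lt.1 h) ha

end ContourComparison

section Residues

theorem tendsto_sub_mul_of_continuousAt {f : ℂ → ℂ} {a : ℂ} (hf : ContinuousAt f a) :
    Tendsto (fun z => (z - a) * f z) (𝓝[≠] a) (𝓝 0) := by
  have hsub : Tendsto (fun z => z - a) (𝓝 a) (𝓝 0) :=
    Continuous.tendsto' (by fun_prop) a 0 (sub_self a)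
  simpa only [zero_mul] using (hsub.mul hf.tendsto).mono_left nhdsWithin_le_nhds

theorem tendsto_sub_mul_inv_sub (a b : ℂ) [Decidable (b = a)] :
    Tendsto (fun z => (z - a) * (z - b)⁻¹) (𝓝[≠] a) (𝓝 (if b = a then 1 else 0)) := by
  split_ifs with h
  · subst h
    refine tendsto_const_nhds.congr' ?_
    filter_upwards [self_mem_nhdsWithin] with z hz
    exact (mul_inv_cancel₀ (sub_ne_zero.2 hz)).symm
  · exact tendsto_sub_mul_of_continuousAt (continuousAt_inv_sub (Ne.symm h))

theorem exists_differentiableOn_add_sum_inv_sub {ι : Type*} {K : Finset ι} {p r : ι → ℂ}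
    {f : ℂ → ℂ} {U : Set ℂ} (hU : IsOpen U) (hp : Set.InjOn p K)
    (hf : ∀ w ∈ U, w ∉ p '' K → DifferentiableAt ℂ f w)
    (hr : ∀ i ∈ K, Tendsto (fun w => (w - p i) * f w) (𝓝[≠] (p i)) (𝓝 (r i))) :
    ∃ h, DifferentiableOn ℂ h U ∧ ∀ w ∉ p '' K, f w = h w + ∑ i ∈ K, r i * (w - p i)⁻¹ := by
  classical
  have hdiff : ∀ w ∈ U, w ∉ p '' K →
      DifferentiableAt ℂ (fun w => f w - ∑ i ∈ K, r i * (w - p i)⁻¹) w := fun w hw hwK => by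
    refine (hf w hw hwK).sub (DifferentiableAt.fun_sum fun i hi => DifferentiableAt.const_mul ?_ _)
    exact DifferentiableAt.inv (by fun_prop) (sub_ne_zero.2 fun h => hwK ⟨i, hi, h.symm⟩)
  obtain ⟨h, hh, heq⟩ := exists_differentiableOn_extension hU (K.finite_toSet.image p) hdiff
    fun q hq _ => by
      obtain ⟨i, hi, rfl⟩ := hq
      have hsum := tendsto_finsetSum K fun j _ =>
        (tendsto_sub_mul_inv_sub (p i) (p j)).const_mul (r j)
      convert (hr i hi).sub hsum using 2 with w
      · rw [smul_eq_mul, mul_sub, Finset.mul_sum]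
        simp only [mul_left_comm]
      · rw [Finset.sum_eq_single_of_mem i hi fun j hj hji => by
            rw [if_neg (hp.ne hj hi hji), mul_zero],
          if_pos rfl, mul_one, sub_self]
  exact ⟨h, hh, fun w hw => by rw [heq w hw, sub_add_cancel]⟩

variable {S : Set ℝ} {T : ℝ}

theorem hasContourDiff_of_differentiableOn_ball (hS : S.Finite) (hT : 0 ≤ T) {f : ℂ → ℂ} {c : ℂ}
    {R : ℝ} (hf : DifferentiableOn ℂ f (Metric.ball c R))
    (hcurve : Set.MapsTo curve (Set.Icc (-T) T) (Metric.ball c R))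
    (hchord : Set.MapsTo (chord T) (Set.uIcc (-angle T) (angle T)) (Metric.ball c R)) :
    HasContourDiff S T f 0 := by
  obtain ⟨F, hF⟩ := hf.isExactOn_ball
  exact .of_primitive hS hT hF hf.continuousOn hcurve hchord

/-- The residue theorem for finitely many simple poles, some of which may lie on the curve. -/
theorem hasContourDiff_of_simple_poles (hS : S.Finite) (hT : 0 ≤ T) {ι : Type*} {K : Finset ι}
    {p r : ι → ℂ} {f : ℂ → ℂ} {c : ℂ} {R : ℝ} (hp : Set.InjOn p K)
    (hf : ∀ w ∈ Metric.ball c R, w ∉ p '' K → DifferentiableAt ℂ f w)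
    (hr : ∀ i ∈ K, Tendsto (fun w => (w - p i) * f w) (𝓝[≠] (p i)) (𝓝 (r i)))
    (hcurve : Set.MapsTo curve (Set.Icc (-T) T) (Metric.ball c R))
    (hchord : Set.MapsTo (chord T) (Set.uIcc (-angle T) (angle T)) (Metric.ball c R))
    (hpS : ∀ i ∈ K, ∀ s, curve s = p i → s ∈ S)
    (hpchord : ∀ i ∈ K, ∀ y ∈ Set.uIcc (-angle T) (angle T), chord T y ≠ p i) :
    HasContourDiff S T f (∑ i ∈ K, r i * (2 * π * I * enclosedWeight T (p i))) := by
  obtain ⟨h, hh, heq⟩ := exists_differentiableOn_add_sum_inv_sub Metric.isOpen_ball hp hf hr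
  have hsum := HasContourDiff.sum fun i hi =>
    (hasContourDiff_inv_sub hS hT (hpchord i hi) (hpS i hi)).const_mul (r i)
  have hadd := (hasContourDiff_of_differentiableOn_ball hS hT hh hcurve hchord).add hsum
  rw [zero_add] at hadd
  refine hadd.congr hS (fun τ _ hτ => heq _ ?_) fun y hy => heq _ ?_
  · rintro ⟨i, hi, hpi⟩
    exact hτ (hpS i hi τ hpi.symm)
  · rintro ⟨i, hi, hpi⟩
    exact hpchord i hi y hy hpi.symm

theorem norm_lt_of_re_le_one {a : ℝ} {w : ℂ} (ha : a ≤ w.re) (hre : w.re ≤ 1) (him : |w.im| < π) :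
    ‖w‖ < |a| + 1 + π := by
  have habs : |w.re| ≤ |a| + 1 :=
    abs_le.2 ⟨by linarith [neg_abs_le a], by linarith [abs_nonneg a]⟩
  linarith [Complex.norm_le_abs_re_add_abs_im w]

theorem re_le_of_weight_ne_zero {a : ℂ} (h : weight a ≠ 0) : a.re ≤ 1 ∧ |a.im| < π := by
  have him : |a.im| < π := by
    by_contra hge
    exact h (weight_of_pi_le_abs_im (not_lt.1 hge))
  obtain ⟨σ, hσ⟩ := exists_angle_eq him
  refine ⟨?_, him⟩
  by_contra! hre
  rw [weight_of_angle_eq hσ] at h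
  exact h (step_of_neg (sub_neg.2 ((curve_re_le_one σ).trans_lt hre)))

theorem norm_lt_of_enclosedWeight_ne_zero {a : ℂ} (h : enclosedWeight T a ≠ 0) :
    ‖a‖ < |(curve T).re| + 1 + π := by
  obtain ⟨hre, hweight⟩ := ite_ne_right_iff.1 h
  obtain ⟨hone, him⟩ := re_le_of_weight_ne_zero hweight
  exact norm_lt_of_re_le_one hre.le hone him

variable {n : ℕ} {x : ℂ}

/-- The residue of `kernel n x` at `pole x k`. -/
noncomputable def kernelResidue (n : ℕ) (x : ℂ) (k : ℤ) : ℂ :=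
  if k = 0 then bernoulliCoeff (n * x) n / x ^ n else Complex.exp (n * pole x k) / pole x k ^ n

/-- The part of the principal part of `kernel n x` at the origin that has a primitive. -/
noncomputable def kernelHigherPart (n : ℕ) (x w : ℂ) : ℂ :=
  ∑ j ∈ Finset.range n, bernoulliCoeff (n * x) j / x ^ j * w ^ ((j : ℤ) - n - 1)

theorem pole_ne_zero (hx : x ≠ 0) {k : ℤ} (hk : k ≠ 0) : pole x k ≠ 0 :=
  pole_zero x ▸ (pole_injective hx).ne hk

theorem exp_pole_div (hx : x ≠ 0) (k : ℤ) : Complex.exp (pole x k / x) = 1 :=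
  (exp_div_eq_one_iff hx).2 ⟨k, rfl⟩

theorem differentiableAt_kernelHigherPart {w : ℂ} (hw : w ≠ 0) :
    DifferentiableAt ℂ (kernelHigherPart n x) w :=
  DifferentiableAt.fun_sum fun _ _ => (differentiableAt_zpow.2 (Or.inl hw)).const_mul _

theorem hasDerivAt_zpow_div {w : ℂ} (hw : w ≠ 0) {m : ℤ} (hm : m ≠ 0) :
    HasDerivAt (fun w : ℂ => w ^ m / m) (w ^ (m - 1)) w := by
  refine ((hasDerivAt_zpow m w (Or.inl hw)).div_const _).congr_deriv ?_
  rw [mul_div_cancel_left₀ _ (Int.cast_ne_zero.2 hm)]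

theorem hasContourDiff_kernelHigherPart (hS : S.Finite) (hT : 0 ≤ T)
    (hchord : ∀ y ∈ Set.uIcc (-angle T) (angle T), chord T y ≠ 0) :
    HasContourDiff S T (kernelHigherPart n x) 0 := by
  refine .of_primitive (U := {0}ᶜ) hS hT (F := fun w => ∑ j ∈ Finset.range n,
    bernoulliCoeff (n * x) j / x ^ j * (w ^ ((j : ℤ) - n) / ((j - n : ℤ) : ℂ))) (fun w hw => ?_)
    (fun w hw => (differentiableAt_kernelHigherPart hw).continuousAt.continuousWithinAt)
    (fun τ _ => curve_ne_zero τ) hchord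
  refine HasDerivAt.fun_sum fun j hj => (hasDerivAt_zpow_div hw ?_).const_mul _
  have hjn := Finset.mem_range.1 hj
  lia

theorem tendsto_sub_pole_mul_kernel (hx : x ≠ 0) {k : ℤ} (hk : k ≠ 0) :
    Tendsto (fun w => (w - pole x k) * kernel n x w) (𝓝[≠] (pole x k))
      (𝓝 (Complex.exp (n * pole x k) / pole x k ^ n)) := by
  have hderiv : HasDerivAt (fun w => x * (Complex.exp (w / x) - 1)) 1 (pole x k) := by
    refine ((((hasDerivAt_id' (pole x k)).div_const x).cexp).sub_const 1).const_mul x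
      |>.congr_deriv ?_
    rw [exp_pole_div hx, one_mul, mul_one_div_cancel hx]
  have hslope := hderiv.tendsto_slope.inv₀ one_ne_zero
  have hcont : ContinuousAt (fun w => Complex.exp (n * w) / w ^ n) (pole x k) :=
    ContinuousAt.div (by fun_prop) (by fun_prop) (pow_ne_zero _ (pole_ne_zero hx hk))
  have hlim := (hcont.tendsto.mono_left (nhdsWithin_le_nhds (s := {pole x k}ᶜ))).mul hslope
  rw [inv_one, mul_one] at hlim
  refine hlim.congr fun w => ?_
  rw [slope_def_field, exp_pole_div hx, kernel, sub_self, mul_zero, sub_zero, inv_div,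
    div_mul_div_comm, mul_comm (w - pole x k), div_mul_eq_mul_div]

theorem mul_kernel_sub_kernelHigherPart (hx : x ≠ 0) {w : ℂ} (hw : w ≠ 0) :
    w * (kernel n x w - kernelHigherPart n x w) =
      (w / x * Complex.exp (n * x * (w / x)) / (Complex.exp (w / x) - 1) -
        ∑ j ∈ Finset.range (n + 1), bernoulliCoeff (n * x) j * (w / x) ^ j) / (w / x) ^ n / x ^ n +
      bernoulliCoeff (n * x) n / x ^ n := by
  have hkernel : w * kernel n x w = w / x * Complex.exp (n * x * (w / x)) /
      (Complex.exp (w / x) - 1) / (w / x) ^ n / x ^ n := by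
    rw [show (n : ℂ) * x * (w / x) = n * w by field_simp, kernel, div_pow]
    field_simp
  have hpart : w * kernelHigherPart n x w =
      (∑ j ∈ Finset.range n, bernoulliCoeff (n * x) j * (w / x) ^ j) / (w / x) ^ n / x ^ n := by
    rw [kernelHigherPart, Finset.mul_sum, Finset.sum_div, Finset.sum_div]
    refine Finset.sum_congr rfl fun j _ => ?_
    rw [zpow_sub_one₀ hw, zpow_sub₀ hw, zpow_natCast, zpow_natCast, div_pow, div_pow]
    field_simp
  rw [mul_sub, hkernel, hpart, Finset.sum_range_succ]
  field_simp
  ring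

theorem tendsto_mul_kernel_sub_kernelHigherPart (hx : x ≠ 0) :
    Tendsto (fun w => w * (kernel n x w - kernelHigherPart n x w)) (𝓝[≠] 0)
      (𝓝 (bernoulliCoeff (n * x) n / x ^ n)) := by
  have hscale : Tendsto (fun w : ℂ => w / x) (𝓝[≠] 0) (𝓝[≠] 0) := by
    refine tendsto_nhdsWithin_iff.2
      ⟨(Continuous.tendsto' (by fun_prop) 0 0 (zero_div x)).mono_left nhdsWithin_le_nhds, ?_⟩
    filter_upwards [self_mem_nhdsWithin] with w hw
    exact div_ne_zero hw hx
  have hlim := (((tendsto_bernoulli_remainder (n * x) n).comp hscale).div_const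
    (x ^ n)).add_const (bernoulliCoeff (n * x) n / x ^ n)
  rw [zero_div, zero_add] at hlim
  refine hlim.congr' ?_
  filter_upwards [self_mem_nhdsWithin] with w hw
  exact (mul_kernel_sub_kernelHigherPart hx hw).symm

theorem tendsto_sub_pole_mul_kernel_sub_kernelHigherPart (hx : x ≠ 0) (k : ℤ) :
    Tendsto (fun w => (w - pole x k) * (kernel n x w - kernelHigherPart n x w)) (𝓝[≠] (pole x k))
      (𝓝 (kernelResidue n x k)) := by
  rw [kernelResidue]
  split_ifs with hk
  · simpa only [hk, pole_zero, sub_zero] using tendsto_mul_kernel_sub_kernelHigherPart hx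
  · have hpart := tendsto_sub_mul_of_continuousAt
      (differentiableAt_kernelHigherPart (n := n) (x := x) (pole_ne_zero hx hk)).continuousAt
    simpa only [mul_sub, sub_zero] using (tendsto_sub_pole_mul_kernel hx hk).sub hpart

theorem hasContourDiff_kernel_sub_kernelHigherPart (hx : x ≠ 0) (hT : 0 ≤ T)
    (hchord : ∀ y ∈ Set.uIcc (-angle T) (angle T), Complex.exp (chord T y / x) ≠ 1)
    {K : Finset ℤ} (hK : ∀ k, k ∈ K ↔ ‖pole x k‖ ≤ |(curve T).re| + 1 + π) :
    HasContourDiff (singularSet x) T (fun w => kernel n x w - kernelHigherPart n x w)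
      (∑ k ∈ K, kernelResidue n x k * (2 * π * I * enclosedWeight T (pole x k))) := by
  refine hasContourDiff_of_simple_poles (c := 0) (R := |(curve T).re| + 1 + π)
    (finite_singularSet hx) hT (pole_injective hx).injOn (fun w hw hwK => ?_)
    (fun k _ => tendsto_sub_pole_mul_kernel_sub_kernelHigherPart hx k) (fun τ hτ => ?_)
    (fun y hy => ?_) (fun k _ s hs => ?_) fun k _ y hy h => ?_
  · rw [mem_ball_zero_iff] at hw
    have hne : ∀ k, w ≠ pole x k := fun k hk => hwK ⟨k, (hK k).2 (hk ▸ hw.le), hk.symm⟩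
    have hw0 : w ≠ 0 := pole_zero x ▸ hne 0
    refine (differentiableAt_kernel hx hw0 fun hexp => ?_).sub
      (differentiableAt_kernelHigherPart hw0)
    obtain ⟨k, hk⟩ := (exp_div_eq_one_iff hx).1 hexp
    exact hne k hk
  · rw [mem_ball_zero_iff]
    exact norm_lt_of_re_le_one ((curve_re_le_curve_re_iff hT).2 (abs_le.2 hτ))
      (curve_re_le_one τ) (abs_curve_im_lt_pi τ)
  · rw [mem_ball_zero_iff]
    refine norm_lt_of_re_le_one (chord_re T y).ge ((chord_re T y).trans_le (curve_re_le_one T)) ?_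
    rw [chord_im]
    exact abs_lt_pi_of_mem_uIcc_angle hy
  · rw [mem_singularSet_iff hx, hs, exp_pole_div hx]
  · exact hchord y hy (h ▸ exp_pole_div hx k)

/-- The infinite sum is in fact finite: `enclosedWeight T` vanishes at all but finitely many
poles. -/
theorem hasContourDiff_kernel (hx : x ≠ 0) (hT : 0 ≤ T)
    (hchord : ∀ y ∈ Set.uIcc (-angle T) (angle T), Complex.exp (chord T y / x) ≠ 1) {s : ℂ}
    (hs : HasSum (fun k => kernelResidue n x k * enclosedWeight T (pole x k)) s) :
    HasContourDiff (singularSet x) T (kernel n x) (2 * π * I * s) := by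
  have hfin := finite_norm_pole_le hx (|(curve T).re| + 1 + π)
  have hsum := hasSum_sum_of_ne_finset_zero (L := .unconditional ℤ) (s := hfin.toFinset)
    (f := fun k => kernelResidue n x k * enclosedWeight T (pole x k)) fun k hk => by
      by_contra h
      have hweight := Complex.ofReal_ne_zero.1 (right_ne_zero_of_mul h)
      exact hk (hfin.mem_toFinset.2 (norm_lt_of_enclosedWeight_ne_zero hweight).le)
  have hadd := (hasContourDiff_kernel_sub_kernelHigherPart (n := n) hx hT hchord
    fun k => hfin.mem_toFinset).add (hasContourDiff_kernelHigherPart (n := n) (x := x)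
      (finite_singularSet hx) hT fun y hy h => hchord y hy (by rw [h, zero_div, Complex.exp_zero]))
  rw [add_zero] at hadd
  simp only [sub_add_cancel] at hadd
  convert hadd using 1
  rw [hs.unique hsum, Finset.mul_sum]
  exact Finset.sum_congr rfl fun k _ => mul_left_comm _ _ _

end Residues

section Limit

theorem tendsto_of_eventually_tendsto {α ι X : Type*} [TopologicalSpace X] {l : Filter ι} [l.NeBot]
    {m : Filter α} {F : α → X} {L : ι → X} {L' : X} (hF : ∀ᶠ i in l, Tendsto F m (𝓝 (L i)))
    (hL : Tendsto L l (𝓝 L')) : Tendsto F m (𝓝 L') := by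
  refine tendsto_nhds.2 fun U hU hLU => ?_
  obtain ⟨i, hFi, hLi⟩ := (hF.and (hL.eventually_mem (hU.mem_nhds hLU))).exists
  exact hFi (hU.mem_nhds hLi)

variable {n : ℕ} {x : ℂ}

theorem norm_kernel_chord_le (hn : 1 ≤ n) (hx : x ≠ 0) {T y δ : ℝ} (hδ : 0 < δ)
    (hT : (curve T).re ≤ -1) (h : δ ≤ ‖Complex.exp (chord T y / x) - 1‖) :
    ‖kernel n x (chord T y)‖ ≤ (‖x‖ * δ)⁻¹ * Real.exp (curve T).re := by
  have hbase : 1 ≤ ‖chord T y‖ := by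
    refine le_trans ?_ (Complex.abs_re_le_norm _)
    rw [chord_re]
    exact (le_neg.2 hT).trans (neg_le_abs _)
  have hnum : ‖Complex.exp (n * chord T y)‖ ≤ Real.exp (curve T).re := by
    rw [Complex.norm_exp, Real.exp_le_exp, ← Complex.ofReal_natCast, Complex.re_ofReal_mul,
      chord_re]
    exact mul_le_of_one_le_left (by linarith) (mod_cast hn)
  rw [kernel, norm_div, norm_mul, norm_mul, norm_pow, ← div_eq_inv_mul,
    ← one_mul (‖x‖ * δ)]
  have hden : 0 < ‖x‖ * δ := mul_pos (norm_pos_iff.2 hx) hδ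
  exact div_le_div₀ (Real.exp_nonneg _) hnum (by rwa [one_mul])
    (mul_le_mul (one_le_pow₀ hbase) (mul_le_mul_of_nonneg_left h (norm_nonneg x)) hden.le
      (by positivity))

theorem tendsto_integral_kernel_chord (hn : 1 ≤ n) (hx : x ≠ 0) {ι : Type*} {l : Filter ι}
    {T : ι → ℝ} (hT : Tendsto T l atTop) {δ : ℝ} (hδ : 0 < δ)
    (hsep : ∀ᶠ i in l, ∀ y, |y| ≤ π → δ ≤ ‖Complex.exp (chord (T i) y / x) - 1‖) :
    Tendsto (fun i => ∫ y in -angle (T i)..angle (T i), kernel n x (chord (T i) y) * I) l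
      (𝓝 0) := by
  have hre : Tendsto (fun i => (curve (T i)).re) l atBot := tendsto_curve_re.comp hT
  have hbound : Tendsto (fun i => (‖x‖ * δ)⁻¹ * Real.exp (curve (T i)).re * (2 * π)) l (𝓝 0) := by
    simpa only [mul_zero, zero_mul, Function.comp_apply] using
      ((Real.tendsto_exp_atBot.comp hre).const_mul (‖x‖ * δ)⁻¹).mul_const (2 * π)
  refine squeeze_zero_norm' ?_ hbound
  filter_upwards [hre.eventually_le_atBot (-1), hsep, hT.eventually_ge_atTop 0] with i hi hsepi hTi
  refine (intervalIntegral.norm_integral_le_of_norm_le_const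
    (C := (‖x‖ * δ)⁻¹ * Real.exp (curve (T i)).re) fun y hy => ?_).trans ?_
  · rw [norm_mul, Complex.norm_I, mul_one]
    exact norm_kernel_chord_le hn hx hδ hi
      (hsepi y (abs_lt_pi_of_mem_uIcc_angle (Set.uIoc_subset_uIcc hy)).le)
  · gcongr
    rw [sub_neg_eq_add, ← two_mul, abs_of_nonneg (by linarith [angle_nonneg hTi])]
    linarith [angle_lt_pi (T i)]

theorem tendsto_setIntegral_integrand_awayFrom (hn : 1 ≤ n) (hx : x ≠ 0) {T : ℝ} {D : ℂ}
    (hD : HasContourDiff (singularSet x) T (kernel n x) D)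
    (hT : IntegrableOn (integrand n x) (Set.Icc (-T) T)ᶜ) :
    Tendsto (fun ε : ℝ => ∫ τ in awayFrom (singularSet x) ε, integrand n x τ) (𝓝[>] 0)
      (𝓝 (Complex.exp (-n) / I *
        (D + ∫ y in -angle T..angle T, kernel n x (chord T y) * I) +
        ∫ τ in (Set.Icc (-T) T)ᶜ, integrand n x τ)) := by
  refine ((hD.tendsto.const_mul (Complex.exp (-n) / I)).add
    (tendsto_setIntegral_awayFrom_inter (finite_singularSet hx) hT)).congr' ?_
  filter_upwards [self_mem_nhdsWithin] with ε (hε : 0 < ε)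
  rw [← integral_inter_add_sdiff (measurableSet_Icc (a := -T) (b := T))
    (integrableOn_integrand_awayFrom hn hx hε), Set.sdiff_eq, ← integral_const_mul]
  simp only [integrand_eq hx]

theorem hasPVIntegral_of_tendsto (hn : 1 ≤ n) (hx : x ≠ 0) {ι : Type*} {l : Filter ι} [l.NeBot]
    {T : ι → ℝ} (hT : Tendsto T l atTop) {δ : ℝ} (hδ : 0 < δ)
    (hsep : ∀ᶠ i in l, ∀ y, |y| ≤ π → δ ≤ ‖Complex.exp (chord (T i) y / x) - 1‖)
    {s : ι → ℂ} {s' : ℂ}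
    (hs : ∀ᶠ i in l, HasSum (fun k => kernelResidue n x k * enclosedWeight (T i) (pole x k)) (s i))
    (hs' : Tendsto s l (𝓝 s')) :
    HasPVIntegral (integrand n x) (singularSet x) (2 * π * Complex.exp (-n) * s') := by
  refine ⟨fun ε hε => integrableOn_integrand_awayFrom hn hx hε, ?_⟩
  obtain ⟨T₀, hT₀⟩ := exists_integrableOn_integrand_compl_Icc hn hx
  have hlim := ((((hs'.const_mul (2 * π * I)).add
    (tendsto_integral_kernel_chord hn hx hT hδ hsep)).const_mul (Complex.exp (-n) / I)).add
      ((tendsto_setIntegral_compl_Icc hT₀).comp hT))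
  have hvalue : 2 * π * Complex.exp (-n) * s' =
      Complex.exp (-n) / I * (2 * π * I * s' + 0) + 0 := by
    field_simp
    ring
  rw [hvalue]
  refine tendsto_of_eventually_tendsto ?_ hlim
  filter_upwards [hsep, hs, hT.eventually_ge_atTop 0, hT.eventually_ge_atTop T₀]
    with i hsepi hsi hTi hT₀i
  refine tendsto_setIntegral_integrand_awayFrom hn hx
    (hasContourDiff_kernel hx hTi (fun y hy hexp => ?_) hsi)
    (hT₀.mono_set (Set.compl_subset_compl.2 (Set.Icc_subset_Icc (neg_le_neg hT₀i) hT₀i)))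
  have hle := hsepi y (abs_lt_pi_of_mem_uIcc_angle hy).le
  rw [hexp, sub_self, norm_zero] at hle
  exact hδ.not_ge hle

end Limit

section Rays

theorem step_mul_of_pos {c : ℝ} (hc : 0 < c) (a : ℝ) : step (c * a) = step a := by
  simp only [step, mul_pos_iff_of_pos_left hc, mul_eq_zero, hc.ne', false_or]

theorem step_sin {u : ℝ} (hu : |u| < π) : step (Real.sin u) = step u := by
  rw [abs_lt] at hu
  rcases lt_trichotomy u 0 with h | rfl | h
  · rw [step_of_neg h, step_of_neg (Real.sin_neg_of_neg_of_neg_pi_lt h hu.1)]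
  · rw [Real.sin_zero]
  · rw [step_of_pos h, step_of_pos (Real.sin_pos_of_pos_of_lt_pi h hu.2)]

theorem weight_conj (a : ℂ) : weight (conj a) = weight a := by
  simp only [weight, Complex.conj_im, Complex.conj_re, abs_neg, Real.cos_neg, Real.sinc_neg]

theorem arg_mem_Ioo_of_im_pos {z : ℂ} (hz : 0 < z.im) : z.arg ∈ Set.Ioo 0 π :=
  ⟨(Complex.arg_nonneg_iff.2 hz.le).lt_of_ne' fun h => hz.ne' (Complex.arg_eq_zero_iff.1 h).2,
    (Complex.arg_le_pi z).lt_of_ne fun h => hz.ne' (Complex.arg_eq_pi_iff.1 h).2⟩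

theorem weight_ofReal_mul_of_im_pos {z : ℂ} (hz : 0 < z.im) {t : ℝ} (ht : 0 < t) :
    weight (t * z) = step (z.arg / z.im - t) := by
  have hscale : step (z.arg / z.im - t) = step (z.arg - t * z.im) := by
    rw [← step_mul_of_pos hz, mul_sub, mul_div_cancel₀ _ hz.ne', mul_comm t]
  obtain ⟨harg, hargpi⟩ := arg_mem_Ioo_of_im_pos hz
  have him := mul_pos ht hz
  rcases lt_or_ge (t * z.im) π with hlt | hge
  · have hlt' : |t * z.im| < π := by rwa [abs_of_pos him]
    have hsinc := sinc_pos_of_abs_lt_pi hlt'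
    have hslope : z.re * Real.sin z.arg = z.im * Real.cos z.arg := by
      rw [← Complex.norm_mul_cos_arg, ← Complex.norm_mul_sin_arg]
      ring
    have hsin : Real.sin (t * z.im) = Real.sinc (t * z.im) * (t * z.im) := by
      rw [Real.sinc_of_ne_zero him.ne', div_mul_cancel₀ _ him.ne']
    have hkey : Real.sinc (t * z.im) * Real.sin z.arg *
        (Real.cos (t * z.im) / Real.sinc (t * z.im) - t * z.re) = Real.sin (z.arg - t * z.im) := by
      rw [Real.sin_sub, hsin]
      field_simp
      linear_combination -(Real.sinc (t * z.im) * t) * hslope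
    rw [hscale, weight, Complex.im_ofReal_mul, Complex.re_ofReal_mul, if_pos hlt',
      ← step_mul_of_pos (mul_pos hsinc (Real.sin_pos_of_pos_of_lt_pi harg hargpi)), hkey,
      step_sin (abs_lt.2 ⟨by linarith, by linarith⟩)]
  · rw [hscale, step_of_neg (by linarith), weight_of_pi_le_abs_im]
    rwa [Complex.im_ofReal_mul, abs_of_pos him]

theorem weight_ofReal_mul {z : ℂ} (hz : z.im ≠ 0) {t : ℝ} (ht : 0 < t) :
    weight (t * z) = step (z.arg / z.im - t) := by
  rcases hz.lt_or_gt with h | h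
  · have hconj := weight_ofReal_mul_of_im_pos (z := conj z) (by rwa [Complex.conj_im, neg_pos]) ht
    have harg : z.arg ≠ π := fun harg => hz (Complex.arg_eq_pi_iff.1 harg).2
    rwa [Complex.arg_conj, if_neg harg, Complex.conj_im, neg_div_neg_eq, ← Complex.conj_ofReal,
      ← map_mul, weight_conj] at hconj
  · exact weight_ofReal_mul_of_im_pos h ht

theorem weight_ofReal (a : ℝ) : weight a = step (1 - a) := by
  rw [weight, Complex.ofReal_im, Complex.ofReal_re, abs_zero, if_pos Real.pi_pos, Real.cos_zero,
    Real.sinc_zero, div_one]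

/-- `s` is the sum over `k ≥ 1` of `a k` times the enclosed weight of the point `2πkz`. The rays
spanned by `z = ix` and `z = -ix` carry the poles `2πikx` with `k > 0` and with `k < 0`. -/
def HasRaySum (z : ℂ) (a : ℕ → ℂ) (T : ℝ) (s : ℂ) : Prop :=
  HasSum (fun k : ℕ => a (k + 1) * enclosedWeight T ((2 * π * (k + 1 : ℕ) : ℝ) * z)) s

variable {z : ℂ} {a : ℕ → ℂ} {T : ℝ}

theorem hasRaySum_cutoffSum {c : ℝ}
    (hweight : ∀ k : ℕ, 0 < k → weight ((2 * π * k : ℝ) * z) = step (c - k))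
    (hre : ∀ k ∈ Finset.Icc 1 ⌊c⌋₊, (curve T).re < ((2 * π * k : ℝ) * z).re) :
    HasRaySum z a T (cutoffSum c a) := by
  have hzero : ∀ k ∉ Finset.range ⌊c⌋₊,
      a (k + 1) * enclosedWeight T ((2 * π * (k + 1 : ℕ) : ℝ) * z) = 0 := fun k hk => by
    have hck : c < (k + 1 : ℕ) :=
      Nat.lt_of_floor_lt (Nat.lt_succ_of_le (not_lt.1 fun h => hk (Finset.mem_range.2 h)))
    rw [enclosedWeight, hweight _ k.succ_pos, step_of_neg (sub_neg.2 hck), ite_self,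
      Complex.ofReal_zero, mul_zero]
  have hvalue : cutoffSum c a = ∑ k ∈ Finset.range ⌊c⌋₊,
      a (k + 1) * enclosedWeight T ((2 * π * (k + 1 : ℕ) : ℝ) * z) := by
    rw [cutoffSum, ← Finset.Ico_add_one_right_eq_Icc, Finset.sum_Ico_eq_sum_range,
      Nat.add_sub_cancel]
    refine Finset.sum_congr rfl fun k hk => ?_
    rw [add_comm 1 k, enclosedWeight, hweight _ k.succ_pos, if_pos (hre _ (Finset.mem_Icc.2
      ⟨k.succ_pos, Finset.mem_range.1 hk⟩)), mul_comm]
  rw [hvalue]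
  exact hasSum_sum_of_ne_finset_zero hzero

theorem step_div_sub_two_pi_mul (b d k : ℝ) :
    step (b / d - 2 * π * k) = step (b / (2 * π * d) - k) := by
  rw [← step_mul_of_pos Real.two_pi_pos (b / (2 * π * d) - k), mul_sub, ← mul_div_assoc,
    mul_div_mul_left _ _ Real.two_pi_pos.ne']

theorem eventually_hasRaySum_of_im_ne_zero (hz : z.im ≠ 0) (a : ℕ → ℂ) :
    ∀ᶠ T in atTop, HasRaySum z a T (cutoffSum (z.arg / (2 * π * z.im)) a) := by
  filter_upwards [(eventually_all_finset _).2 fun (k : ℕ)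
    (_ : k ∈ Finset.Icc 1 ⌊z.arg / (2 * π * z.im)⌋₊) =>
      tendsto_curve_re.eventually_lt_atBot ((2 * π * k : ℝ) * z).re] with T hT
  refine hasRaySum_cutoffSum (fun k hk => ?_) hT
  rw [weight_ofReal_mul hz (mul_pos Real.two_pi_pos (mod_cast hk)), step_div_sub_two_pi_mul]

theorem hasRaySum_ofReal_of_pos {q : ℝ} (hq : 0 < q) (hT : (curve T).re ≤ 0) :
    HasRaySum q a T (cutoffSum (1 / (2 * π * q)) a) := by
  refine hasRaySum_cutoffSum (fun k _ => ?_) fun k hk => hT.trans_lt ?_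
  · rw [← Complex.ofReal_mul, weight_ofReal, ← step_div_sub_two_pi_mul,
      ← step_mul_of_pos hq (1 / q - 2 * π * k), mul_sub, mul_one_div_cancel hq.ne', mul_comm q]
  · have hkpos : (0 : ℝ) < k := mod_cast (Finset.mem_Icc.1 hk).1
    rw [← Complex.ofReal_mul, Complex.ofReal_re]
    positivity

theorem enclosedWeight_ofReal_of_neg {q : ℝ} (hq : q < 0) {N k : ℕ}
    (hT : (curve T).re = q * (2 * π * N + π)) :
    enclosedWeight T ((2 * π * k : ℝ) * q) = if k ≤ N then 1 else 0 := by
  have hiff : (curve T).re < 2 * π * k * q ↔ k ≤ N := by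
    rw [hT, mul_comm (2 * π * (k : ℝ)), mul_lt_mul_left_of_neg hq]
    refine ⟨fun h => ?_, fun h => ?_⟩
    · by_contra! hlt
      have hcast : (N : ℝ) + 1 ≤ k := mod_cast hlt
      nlinarith [Real.pi_pos]
    · have hcast : (k : ℝ) ≤ N := mod_cast h
      nlinarith [Real.pi_pos]
  have hpos : 0 < 1 - 2 * π * k * q := by
    have hle : 2 * π * k * q ≤ 0 := mul_nonpos_of_nonneg_of_nonpos (by positivity) hq.le
    linarith
  rw [enclosedWeight, ← Complex.ofReal_mul, Complex.ofReal_re, weight_ofReal, step_of_pos hpos]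
  simp only [hiff]

theorem hasRaySum_ofReal_of_neg {q : ℝ} (hq : q < 0) {N : ℕ}
    (hT : (curve T).re = q * (2 * π * N + π)) :
    HasRaySum q a T (∑ k ∈ Finset.range N, a (k + 1)) := by
  simp only [HasRaySum, enclosedWeight_ofReal_of_neg hq hT, Nat.add_one_le_iff]
  convert hasSum_sum_of_ne_finset_zero (L := .unconditional ℕ) (s := Finset.range N)
    (f := fun k => a (k + 1) * ((if k < N then 1 else 0 : ℝ) : ℂ)) fun k hk => ?_ using 1
  · refine Finset.sum_congr rfl fun k hk => ?_
    rw [if_pos (Finset.mem_range.1 hk), Complex.ofReal_one, mul_one]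
  · rw [if_neg fun h => hk (Finset.mem_range.2 h), Complex.ofReal_zero, mul_zero]

variable {n : ℕ} {x : ℂ}

theorem hasSum_kernelResidue_mul_enclosedWeight {A B : ℂ} (hT : (curve T).re < 0)
    (hA : HasRaySum (I * x) (fun k => kernelResidue n x k) T A)
    (hB : HasRaySum (-I * x) (fun k => kernelResidue n x (-k)) T B) :
    HasSum (fun k => kernelResidue n x k * enclosedWeight T (pole x k))
      (bernoulliCoeff (n * x) n / x ^ n + (A + B)) := by
  have hzero : kernelResidue n x 0 * enclosedWeight T (pole x 0) =
      bernoulliCoeff (n * x) n / x ^ n := by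
    have hweight : weight 0 = 1 := by
      rw [← Complex.ofReal_zero, weight_ofReal, sub_zero, step_of_pos one_pos]
    rw [kernelResidue, if_pos rfl, pole_zero, enclosedWeight, Complex.zero_re, if_pos hT,
      hweight, Complex.ofReal_one, mul_one]
  have hpos : ∀ k : ℕ, ((2 * π * (k + 1 : ℕ) : ℝ) : ℂ) * (I * x) = pole x (k + 1) := fun k => by
    rw [pole]
    push_cast
    ring
  have hneg : ∀ k : ℕ, ((2 * π * (k + 1 : ℕ) : ℝ) : ℂ) * (-I * x) = pole x (-(k + 1)) :=
    fun k => by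
      rw [pole]
      push_cast
      ring
  simp only [HasRaySum, hpos, hneg] at hA hB
  simp only [Nat.cast_succ] at hA hB
  rw [← hzero, add_left_comm, ← add_assoc]
  exact HasSum.of_add_one_of_neg_add_one
    (f := fun k => kernelResidue n x k * enclosedWeight T (pole x k)) hA hB

theorem hasPVIntegral_of_tendsto_hasRaySum (hn : 1 ≤ n) (hx : x ≠ 0) {ι : Type*} {l : Filter ι}
    [l.NeBot] {T : ι → ℝ} (hT : Tendsto T l atTop) {δ : ℝ} (hδ : 0 < δ)
    (hsep : ∀ᶠ i in l, ∀ y, |y| ≤ π → δ ≤ ‖Complex.exp (chord (T i) y / x) - 1‖)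
    {A B : ι → ℂ} {A' B' : ℂ}
    (hA : ∀ᶠ i in l, HasRaySum (I * x) (fun k => kernelResidue n x k) (T i) (A i))
    (hB : ∀ᶠ i in l, HasRaySum (-I * x) (fun k => kernelResidue n x (-k)) (T i) (B i))
    (hA' : Tendsto A l (𝓝 A')) (hB' : Tendsto B l (𝓝 B')) :
    HasPVIntegral (integrand n x) (singularSet x)
      (2 * π * Complex.exp (-n) * (bernoulliCoeff (n * x) n / x ^ n + (A' + B'))) := by
  refine hasPVIntegral_of_tendsto hn hx hT hδ hsep ?_ ((hA'.add hB').const_add _)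
  filter_upwards [(tendsto_curve_re.comp hT).eventually_lt_atBot 0, hA, hB] with i hTi hAi hBi
  exact hasSum_kernelResidue_mul_enclosedWeight hTi hAi hBi

end Rays

section ResidueSums

variable {n : ℕ} {x : ℂ}

theorem mul_cutoffSum {c : ℝ} {a b : ℕ → ℂ} {u v : ℂ} (h : ∀ k, k ≠ 0 → u * a k = v * b k) :
    u * cutoffSum c a = v * cutoffSum c b := by
  rw [cutoffSum, cutoffSum, Finset.mul_sum, Finset.mul_sum]
  refine Finset.sum_congr rfl fun k hk => ?_
  rw [mul_left_comm, h k (Nat.one_le_iff_ne_zero.1 (Finset.mem_Icc.1 hk).1), mul_left_comm]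

theorem pow_mul_kernelResidue (hx : x ≠ 0) {k : ℤ} (hk : k ≠ 0) :
    x ^ n * kernelResidue n x k =
      1 / (2 * π) ^ n * (Complex.exp (2 * k * π * I * n * x) / (I * k) ^ n) := by
  have hexponent : n * pole x k = 2 * k * π * I * n * x := by
    rw [pole]
    ring
  have hpow : pole x k ^ n = x ^ n * ((2 * π) ^ n * (I * k) ^ n) := by
    rw [pole, ← mul_pow, ← mul_pow]
    ring
  rw [kernelResidue, if_neg hk, hexponent, hpow, mul_div_assoc',
    mul_div_mul_left _ _ (pow_ne_zero n hx), div_mul_div_comm, one_mul]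

theorem pow_mul_cutoffSum_kernelResidue (hx : x ≠ 0) (c : ℝ) :
    x ^ n * cutoffSum c (fun k => kernelResidue n x k) = 1 / (2 * π) ^ n *
      cutoffSum c fun k => Complex.exp (2 * k * π * I * n * x) / (I * k) ^ n :=
  mul_cutoffSum fun _ hk => pow_mul_kernelResidue hx (Int.natCast_ne_zero.2 hk)

theorem pow_mul_cutoffSum_kernelResidue_neg (hx : x ≠ 0) (c : ℝ) :
    x ^ n * cutoffSum c (fun k => kernelResidue n x (-k)) = 1 / (2 * π) ^ n *
      cutoffSum c fun k => Complex.exp (-(2 * k * π * I * n * x)) / (-I * k) ^ n := by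
  refine mul_cutoffSum fun k hk => ?_
  rw [pow_mul_kernelResidue hx (neg_ne_zero.2 (Int.natCast_ne_zero.2 hk))]
  simp only [Int.cast_neg, Int.cast_natCast, mul_neg, neg_mul]

theorem hasSum_polylog (n : ℕ) {z : ℂ} (hz : ‖z‖ < 1) :
    HasSum (fun k : ℕ => z ^ (k + 1) / ((k : ℂ) + 1) ^ n) (polylog n z) := by
  refine Summable.hasSum (.of_norm_bounded (g := fun k : ℕ => ‖z‖ ^ k)
    (summable_geometric_of_lt_one (norm_nonneg _) hz) fun k => ?_)
  rw [norm_div, norm_pow, norm_pow, ← Nat.cast_succ, Complex.norm_natCast]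
  refine (div_le_self (by positivity) (one_le_pow₀ (mod_cast k.succ_pos))).trans ?_
  exact pow_le_pow_of_le_one (norm_nonneg _) hz.le k.le_succ

theorem hasSum_kernelResidue_of_im_pos (hn : 1 ≤ n) (hx : 0 < x.im) :
    HasSum (fun k : ℕ => kernelResidue n x (k + 1 : ℕ))
      (1 / (2 * π * I) ^ n * polylog n (Complex.exp (2 * π * I * n * x)) / x ^ n) := by
  have him : 0 < ((n : ℂ) * x).im := by
    rw [← Complex.ofReal_natCast, Complex.im_ofReal_mul]
    exact mul_pos (mod_cast hn) hx
  have hnorm := UpperHalfPlane.norm_exp_two_pi_I_lt_one ⟨_, him⟩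
  have hsum := ((hasSum_polylog n hnorm).mul_left (1 / (2 * π * I) ^ n)).div_const (x ^ n)
  rw [mul_assoc _ (n : ℂ)]
  refine hsum.congr_fun fun k => ?_
  have hpow : pole x (k + 1 : ℕ) ^ n = (2 * π * I) ^ n * ((k : ℂ) + 1) ^ n * x ^ n := by
    rw [pole, Int.cast_natCast, Nat.cast_succ, mul_pow, mul_pow]
  have hexponent : n * pole x (k + 1 : ℕ) = (k + 1 : ℕ) * (2 * π * I * (n * x)) := by
    rw [pole, Int.cast_natCast]
    ring
  rw [kernelResidue, if_neg (mod_cast k.succ_ne_zero), hpow, hexponent, Complex.exp_nat_mul,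
    div_mul_div_comm, one_mul, div_div]

theorem kernelResidue_neg_left {k : ℤ} (hk : k ≠ 0) :
    kernelResidue n (-x) k = kernelResidue n x (-k) := by
  rw [kernelResidue, kernelResidue, if_neg hk, if_neg (neg_ne_zero.2 hk), pole_neg_left]

theorem hasSum_kernelResidue_of_im_neg (hn : 1 ≤ n) (hx : x.im < 0) :
    HasSum (fun k : ℕ => kernelResidue n x (-(k + 1 : ℕ)))
      (1 / (-(2 * π * I)) ^ n * polylog n (Complex.exp (-(2 * π * I * n * x))) / x ^ n) := by
  have hsum := hasSum_kernelResidue_of_im_pos (x := -x) hn (by rwa [Complex.neg_im, neg_pos])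
  simp only [kernelResidue_neg_left (Int.natCast_ne_zero.2 (Nat.succ_ne_zero _)), mul_neg] at hsum
  convert hsum using 1
  rw [div_mul_eq_mul_div, div_mul_eq_mul_div, div_div, div_div, ← mul_pow, ← mul_pow, neg_mul_comm]

end ResidueSums

section IntegrandPrincipalValue

theorem exists_curve_re_eq {R : ℝ} (hR : R ≤ 1) : ∃ T, 0 ≤ T ∧ (curve T).re = R := by
  have hcont : Continuous fun t => (curve t).re := Complex.continuous_re.comp continuous_curve
  have hzero : (curve 0).re = 1 := by rw [curve_zero, Complex.one_re]
  obtain ⟨b, hbR, hb⟩ := ((tendsto_curve_re.eventually_le_atBot R).and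
    (eventually_ge_atTop 0)).exists
  obtain ⟨T, hT, hTR⟩ := intermediate_value_Icc' hb hcont.continuousOn ⟨hbR, hR.trans_eq hzero.symm⟩
  exact ⟨T, hT.1, hTR⟩

theorem exists_tendsto_curve_re_eq {ι : Type*} {l : Filter ι} {R : ι → ℝ} (hR : ∀ i, R i ≤ 1)
    (hlim : Tendsto R l atBot) :
    ∃ T : ι → ℝ, Tendsto T l atTop ∧ ∀ i, (curve (T i)).re = R i := by
  choose T hT hTR using fun i => exists_curve_re_eq (hR i)
  refine ⟨T, tendsto_atTop.2 fun b => ?_, hTR⟩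
  filter_upwards [hlim.eventually_le_atBot (curve b).re] with i hi
  exact (le_abs_self b).trans ((curve_re_le_curve_re_iff (hT i)).1 ((hTR i).trans_le hi))

theorem one_le_norm_exp_sub_one_of_cos_nonpos {u : ℂ} (hu : Real.cos u.im ≤ 0) :
    1 ≤ ‖Complex.exp u - 1‖ := by
  refine le_trans ?_ (Complex.abs_re_le_norm _)
  rw [Complex.sub_re, Complex.exp_re, Complex.one_re, abs_sub_comm]
  exact le_abs.2 (.inl (by linarith [mul_nonpos_of_nonneg_of_nonpos (Real.exp_nonneg u.re) hu]))

theorem one_le_norm_exp_chord_div_sub_one {q T : ℝ} {N : ℕ}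
    (hT : (curve T).re = -|q| * (2 * π * N + π)) (hq : q ≠ 0) (y : ℝ) :
    1 ≤ ‖Complex.exp (chord T y / (I * q)) - 1‖ := by
  have him : |(chord T y / (I * q)).im| = N * (2 * π) + π := by
    have hdiv : (chord T y / (I * q)).im = -(curve T).re / q := by
      rw [← div_div, Complex.div_ofReal_im, Complex.div_I, Complex.neg_im, Complex.mul_I_im,
        chord_re]
    rw [hdiv, hT, neg_mul, neg_neg, abs_div, abs_mul, abs_abs,
      mul_div_cancel_left₀ _ (abs_ne_zero.2 hq), abs_of_nonneg (by positivity), mul_comm (2 * π)]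
  refine one_le_norm_exp_sub_one_of_cos_nonpos ?_
  rw [← Real.cos_abs, him, Real.cos_add_pi, Real.cos_nat_mul_two_pi]
  norm_num

variable {n : ℕ}

theorem hasPVIntegral_of_re_ne_zero (hn : 1 ≤ n) {x : ℂ} (hre : x.re ≠ 0) :
    HasPVIntegral (integrand n x) (singularSet x)
      (2 * π * Complex.exp (-n) * (bernoulliCoeff (n * x) n / x ^ n +
        (cutoffSum ((I * x).arg / (2 * π * (I * x).im)) (fun k => kernelResidue n x k) +
          cutoffSum ((-I * x).arg / (2 * π * (-I * x).im)) fun k => kernelResidue n x (-k)))) := by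
  have hx : x ≠ 0 := fun h => hre (by rw [h, Complex.zero_re])
  obtain ⟨R, hR⟩ := exists_forall_le_abs_re_div hre π 1
  have hδ : 0 < 1 - Real.exp (-1) := sub_pos.2 (Real.exp_lt_one_iff.2 (neg_lt_zero.2 one_pos))
  refine hasPVIntegral_of_tendsto_hasRaySum hn hx tendsto_id hδ ?_
    (eventually_hasRaySum_of_im_ne_zero ?_ _) (eventually_hasRaySum_of_im_ne_zero ?_ _)
    tendsto_const_nhds tendsto_const_nhds
  · filter_upwards [tendsto_curve_re.eventually_le_atBot R] with T hT y hy
    have hle := hR (chord T y) (by rwa [chord_re]) (by rwa [chord_im])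
    exact (sub_le_sub_left (Real.exp_le_exp.2 (neg_le_neg hle)) 1).trans
      (one_sub_exp_neg_abs_re_le_norm_exp_sub_one _)
  · rwa [Complex.I_mul_im]
  · rwa [neg_mul, Complex.neg_im, Complex.I_mul_im, neg_ne_zero]

theorem exists_tendsto_curve_re_eq_mul {c : ℝ} (hc : c < 0) :
    ∃ T : ℕ → ℝ, Tendsto T atTop atTop ∧ ∀ N : ℕ, (curve (T N)).re = c * (2 * π * N + π) := by
  refine exists_tendsto_curve_re_eq (fun N => ?_) ((tendsto_atTop_add_const_right _ _
    (tendsto_natCast_atTop_atTop.const_mul_atTop Real.two_pi_pos)).const_mul_atTop_of_neg hc)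
  exact (mul_nonpos_of_nonpos_of_nonneg hc.le (by positivity)).trans zero_le_one

theorem hasPVIntegral_I_mul_of_pos (hn : 1 ≤ n) {q : ℝ} (hq : 0 < q) :
    HasPVIntegral (integrand n (I * q)) (singularSet (I * q))
      (2 * π * Complex.exp (-n) * (bernoulliCoeff (n * (I * q)) n / (I * q) ^ n +
        (1 / (2 * π * I) ^ n * polylog n (Complex.exp (2 * π * I * n * (I * q))) / (I * q) ^ n +
          cutoffSum (1 / (2 * π * q)) fun k => kernelResidue n (I * q) (-k)))) := by
  have hsum := hasSum_kernelResidue_of_im_pos hn (x := I * q)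
    (by rwa [Complex.I_mul_im, Complex.ofReal_re])
  have hx : I * q ≠ 0 := mul_ne_zero Complex.I_ne_zero (Complex.ofReal_ne_zero.2 hq.ne')
  have hleft : I * (I * q) = (-q : ℝ) := by rw [← mul_assoc, Complex.I_mul_I]; push_cast; ring
  have hright : -I * (I * q) = q := by rw [neg_mul, hleft]; push_cast; ring
  obtain ⟨T, hT, hTre⟩ := exists_tendsto_curve_re_eq_mul (neg_lt_zero.2 hq)
  refine hasPVIntegral_of_tendsto_hasRaySum hn hx hT one_pos (.of_forall fun N y _ => ?_)
    (.of_forall fun N => ?_) (.of_forall fun N => ?_) hsum.tendsto_sum_nat tendsto_const_nhds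
  · exact one_le_norm_exp_chord_div_sub_one (by rw [hTre N, abs_of_pos hq]) hq.ne' y
  · rw [hleft]
    exact hasRaySum_ofReal_of_neg (neg_lt_zero.2 hq) (hTre N)
  · rw [hright]
    refine hasRaySum_ofReal_of_pos hq ?_
    rw [hTre]
    exact mul_nonpos_of_nonpos_of_nonneg (neg_nonpos.2 hq.le) (by positivity)

theorem hasPVIntegral_I_mul_of_neg (hn : 1 ≤ n) {q : ℝ} (hq : q < 0) :
    HasPVIntegral (integrand n (I * q)) (singularSet (I * q))
      (2 * π * Complex.exp (-n) * (bernoulliCoeff (n * (I * q)) n / (I * q) ^ n +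
        (cutoffSum (1 / (2 * π * -q)) (fun k => kernelResidue n (I * q) k) +
          1 / (-(2 * π * I)) ^ n * polylog n (Complex.exp (-(2 * π * I * n * (I * q)))) /
            (I * q) ^ n))) := by
  have hsum := hasSum_kernelResidue_of_im_neg hn (x := I * q)
    (by rwa [Complex.I_mul_im, Complex.ofReal_re])
  have hx : I * q ≠ 0 := mul_ne_zero Complex.I_ne_zero (Complex.ofReal_ne_zero.2 hq.ne)
  have hright : I * (I * q) = (-q : ℝ) := by rw [← mul_assoc, Complex.I_mul_I]; push_cast; ring
  have hleft : -I * (I * q) = q := by rw [neg_mul, hright]; push_cast; ring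
  obtain ⟨T, hT, hTre⟩ := exists_tendsto_curve_re_eq_mul hq
  refine hasPVIntegral_of_tendsto_hasRaySum hn hx hT one_pos (.of_forall fun N y _ => ?_)
    (.of_forall fun N => ?_) (.of_forall fun N => ?_) tendsto_const_nhds hsum.tendsto_sum_nat
  · exact one_le_norm_exp_chord_div_sub_one (by rw [hTre N, abs_of_neg hq, neg_neg]) hq.ne y
  · rw [hright]
    refine hasRaySum_ofReal_of_pos (neg_pos.2 hq) ?_
    rw [hTre]
    exact mul_nonpos_of_nonpos_of_nonneg hq.le (by positivity)
  · rw [hleft]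
    exact hasRaySum_ofReal_of_neg hq (hTre N)

end IntegrandPrincipalValue

section BernoulliFormula

variable {n : ℕ} {x : ℂ}

theorem beta_div_factorial_eq_of_hasPVIntegral (hx : x ≠ 0) {J A A' B B' : ℂ}
    (hJ : HasPVIntegral (integrand n x) (singularSet x) J)
    (hvalue : HasPVIntegral (integrand n x) (singularSet x)
      (2 * π * Complex.exp (-n) * (bernoulliCoeff (n * x) n / x ^ n + (A + B))))
    (hA : x ^ n * A = A') (hB : x ^ n * B = B') :
    beta n x / n.factorial = ((Real.exp 1 : ℂ) * x) ^ n / (2 * π) * J - A' - B' := by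
  have hexp : (Real.exp 1 : ℂ) ^ n * Complex.exp (-n) = 1 := by
    rw [Complex.ofReal_exp, Complex.ofReal_one, ← Complex.exp_nat_mul, mul_one, ← Complex.exp_add,
      add_neg_cancel, Complex.exp_zero]
  have hcoeff : x ^ n * (bernoulliCoeff (n * x) n / x ^ n) = beta n x / n.factorial :=
    mul_div_cancel₀ _ (pow_ne_zero n hx)
  have hpi : (2 * π : ℂ) ≠ 0 := mul_ne_zero two_ne_zero (Complex.ofReal_ne_zero.2 Real.pi_ne_zero)
  rw [hJ.unique hvalue, ← hA, ← hB, ← hcoeff, mul_pow, div_mul_eq_mul_div, eq_sub_iff_add_eq,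
    eq_sub_iff_add_eq, eq_div_iff hpi]
  linear_combination -(2 * π * x ^ n * (bernoulliCoeff (n * x) n / x ^ n + (A + B))) * hexp

theorem beta_div_factorial_of_re_ne_zero (hn : 1 ≤ n) (hre : x.re ≠ 0) {J : ℂ}
    (hJ : HasPVIntegral (integrand n x) (singularSet x) J) :
    beta n x / n.factorial = ((Real.exp 1 : ℂ) * x) ^ n / (2 * π) * J
      - 1 / (2 * π) ^ n * cutoffSum ((I * x).arg / (2 * π * (I * x).im))
        (fun k => Complex.exp (2 * k * π * I * n * x) / (I * k) ^ n)
      - 1 / (2 * π) ^ n * cutoffSum ((-I * x).arg / (2 * π * (-I * x).im))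
        (fun k => Complex.exp (-(2 * k * π * I * n * x)) / (-I * k) ^ n) :=
  have hx : x ≠ 0 := fun h => hre (by rw [h, Complex.zero_re])
  beta_div_factorial_eq_of_hasPVIntegral hx hJ (hasPVIntegral_of_re_ne_zero hn hre)
    (pow_mul_cutoffSum_kernelResidue hx _) (pow_mul_cutoffSum_kernelResidue_neg hx _)

theorem exists_hasPVIntegral (hn : 1 ≤ n) (hx : x ≠ 0) :
    ∃ J, HasPVIntegral (integrand n x) (singularSet x) J := by
  by_cases hre : x.re = 0
  · obtain ⟨q, rfl⟩ : ∃ q : ℝ, x = I * q :=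
      ⟨x.im, Complex.ext (by rw [Complex.I_mul_re, Complex.ofReal_im, neg_zero, hre])
        (by rw [Complex.I_mul_im, Complex.ofReal_re])⟩
    have hq : q ≠ 0 := fun h => hx (by rw [h, Complex.ofReal_zero, mul_zero])
    rcases hq.lt_or_gt with hneg | hpos
    · exact ⟨_, hasPVIntegral_I_mul_of_neg hn hneg⟩
    · exact ⟨_, hasPVIntegral_I_mul_of_pos hn hpos⟩
  · exact ⟨_, hasPVIntegral_of_re_ne_zero hn hre⟩

variable {q : ℝ} {J : ℂ}

theorem beta_div_factorial_of_I_mul_pos (hn : 1 ≤ n) (hq : 0 < q)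
    (hJ : HasPVIntegral (integrand n (I * q)) (singularSet (I * q)) J) :
    beta n (I * q) / n.factorial = ((Real.exp 1 : ℂ) * (I * q)) ^ n / (2 * π) * J
      - 1 / (2 * π * I) ^ n * polylog n (Complex.exp (2 * π * I * n * (I * q)))
      - 1 / (2 * π) ^ n * cutoffSum (1 / (2 * π * (I * q).im))
        (fun k => Complex.exp (-(2 * π * I * k * n * (I * q))) / (-I * k) ^ n) := by
  have hx : I * q ≠ 0 := mul_ne_zero Complex.I_ne_zero (Complex.ofReal_ne_zero.2 hq.ne')
  have hcomm (k : ℂ) : 2 * π * I * k = 2 * k * π * I := by ring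
  rw [Complex.I_mul_im, Complex.ofReal_re]
  refine beta_div_factorial_eq_of_hasPVIntegral hx hJ
    (hasPVIntegral_I_mul_of_pos hn hq)
    (mul_div_cancel₀ _ (pow_ne_zero n hx)) ?_
  simp only [pow_mul_cutoffSum_kernelResidue_neg hx, hcomm]

theorem beta_div_factorial_of_I_mul_neg (hn : 1 ≤ n) (hq : q < 0)
    (hJ : HasPVIntegral (integrand n (I * q)) (singularSet (I * q)) J) :
    beta n (I * q) / n.factorial = ((Real.exp 1 : ℂ) * (I * q)) ^ n / (2 * π) * J
      - 1 / (-(2 * π * I)) ^ n * polylog n (Complex.exp (-(2 * π * I * n * (I * q))))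
      - 1 / (2 * π) ^ n * cutoffSum (1 / (2 * π * -(I * q).im))
        (fun k => Complex.exp (2 * π * I * k * n * (I * q)) / (I * k) ^ n) := by
  have hx : I * q ≠ 0 := mul_ne_zero Complex.I_ne_zero (Complex.ofReal_ne_zero.2 hq.ne)
  have hcomm (k : ℂ) : 2 * π * I * k = 2 * k * π * I := by ring
  rw [sub_right_comm, Complex.I_mul_im, Complex.ofReal_re]
  refine beta_div_factorial_eq_of_hasPVIntegral hx hJ
    (hasPVIntegral_I_mul_of_neg hn hq) ?_
    (mul_div_cancel₀ _ (pow_ne_zero n hx))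
  simp only [pow_mul_cutoffSum_kernelResidue hx, hcomm]

end BernoulliFormula

end RescaledBernoulli

theorem mainTheorem4 (n : ℕ) (hn : 1 ≤ n) (x : ℂ) (hx : x ≠ 0) :
    ∃ J : ℂ,
      RescaledBernoulli.HasPVIntegral (RescaledBernoulli.integrand n x)
        (RescaledBernoulli.singularSet x) J ∧
      (x.re ≠ 0 →
        RescaledBernoulli.beta n x / (n.factorial : ℂ) =
          ((Real.exp 1 : ℂ) * x) ^ n / (2 * (Real.pi : ℂ)) * J
          - 1 / (2 * (Real.pi : ℂ)) ^ n *
            RescaledBernoulli.cutoffSum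
              (Complex.arg (Complex.I * x) / (2 * Real.pi * (Complex.I * x).im))
              (fun k => Complex.exp (2 * k * Real.pi * Complex.I * n * x)
                / (Complex.I * k) ^ n)
          - 1 / (2 * (Real.pi : ℂ)) ^ n *
            RescaledBernoulli.cutoffSum
              (Complex.arg (-Complex.I * x) / (2 * Real.pi * (-Complex.I * x).im))
              (fun k => Complex.exp (-(2 * k * Real.pi * Complex.I * n * x))
                / (-Complex.I * k) ^ n)) ∧
      (∀ q : ℝ, 0 < q → x = Complex.I * q →
        RescaledBernoulli.beta n x / (n.factorial : ℂ) =
          ((Real.exp 1 : ℂ) * x) ^ n / (2 * (Real.pi : ℂ)) * J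
          - 1 / (2 * (Real.pi : ℂ) * Complex.I) ^ n *
            RescaledBernoulli.polylog n (Complex.exp (2 * Real.pi * Complex.I * n * x))
          - 1 / (2 * (Real.pi : ℂ)) ^ n *
            RescaledBernoulli.cutoffSum (1 / (2 * Real.pi * x.im))
              (fun k => Complex.exp (-(2 * Real.pi * Complex.I * k * n * x))
                / (-Complex.I * k) ^ n)) ∧
      (∀ q : ℝ, q < 0 → x = Complex.I * q →
        RescaledBernoulli.beta n x / (n.factorial : ℂ) =
          ((Real.exp 1 : ℂ) * x) ^ n / (2 * (Real.pi : ℂ)) * J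
          - 1 / (-(2 * (Real.pi : ℂ) * Complex.I)) ^ n *
            RescaledBernoulli.polylog n (Complex.exp (-(2 * Real.pi * Complex.I * n * x)))
          - 1 / (2 * (Real.pi : ℂ)) ^ n *
            RescaledBernoulli.cutoffSum (1 / (2 * Real.pi * (-x.im)))
              (fun k => Complex.exp (2 * Real.pi * Complex.I * k * n * x)
                / (Complex.I * k) ^ n)) := by
  obtain ⟨J, hJ⟩ := RescaledBernoulli.exists_hasPVIntegral hn hx
  refine ⟨J, hJ, fun hre => RescaledBernoulli.beta_div_factorial_of_re_ne_zero hn hre hJ, ?_, ?_⟩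
  · rintro q hq rfl
    exact RescaledBernoulli.beta_div_factorial_of_I_mul_pos hn hq hJ
  · rintro q hq rfl
    exact RescaledBernoulli.beta_div_factorial_of_I_mul_neg hn hq hJ
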